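/- Let $\mathbb D\subset\mathbb C$ be the open unit disc. For an open set $\Omega\subset\mathbb C$ let $W_0^{1,2}(\Omega)$ be the closure of the real space $C_0^\infty(\Omega)$ in the norm of $W^{1,2}(\Omega)$. A number $\lambda$ is an eigenvalue of the Dirichlet Laplacian in $\Omega$ if there is $0\ne u\in W_0^{1,2}(\Omega)$ (an eigenfunction) with $\int_\Omega\nabla u\cdot\nabla v\,dx\,dy=\lambda\int_\Omega u\,v\,dx\,dy$ for all $v\in W_0^{1,2}(\Omega)$; $\lambda_n[\Omega]$, $n=1,2,\dots$, denotes the $n$-th eigenvalue in non-decreasing order, each eigenvalue being repeated according to its multiplicity, i.e. the least $t$ such that there are $n$ linearly independent eigenfunctions with eigenvalues at most $t$. For $2\le q<\infty$ let $C(q)$ be the best constant in the Sobolev inequality $\|f\|_{L^q(\mathbb D)}\le C(q)\,\|\nabla f\|_{L^2(\mathbb D)}$, $f\in W_0^{1,2}(\mathbb D)$. Let $\varphi_k:\mathbb D\to\Omega_k$ ($k=1,2$) be conformal mappings, that is, holomorphic bijections of $\mathbb D$ onto $\Omega_k$, and suppose that $|\varphi_1'|,|\varphi_2'|\in L^p(\mathbb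 D)$ for some $2<p\le\infty$. Then for every integer $n\ge1$ the eigenvalues $\lambda_n[\Omega_1]$, $\lambda_n[\Omega_2]$ exist and are positive, and, with $c_n=\max\{\lambda_n[\Omega_1]^2,\lambda_n[\Omega_2]^2\}$, $$|\lambda_n[\Omega_1]-\lambda_n[\Omega_2]|\le c_n\Big[C\Big(\frac{4p}{p-2}\Big)\Big]^2\big(\|\varphi_1'\|_{L^p(\mathbb D)}+\|\varphi_2'\|_{L^p(\mathbb D)}\big)\,\big\||\varphi_1'|-|\varphi_2'|\big\|_{L^2(\mathbb D)},$$ where $\frac{4p}{p-2}$ is read as $4$ for $p=\infty$. Moreover, with $J_{\varphi_k}$ the Jacobian of $\varphi_k$, $\mathbb D^+=\{z\in\mathbb D: J_{\varphi_1}(z)\ge J_{\varphi_2}(z)\}$ and $\mathbb D^-=\{z\in\mathbb D: J_{\varphi_1}(z)<J_{\varphi_2}(z)\}$, $$|\lambda_n[\Omega_1]-\lambda_n[\Omega_2]|\le c_n\Big[C\Big(\frac{4p}{p-2}\Big)\Big]^2\big(\|\varphi_1'\|_{L^p(\mathbb D)}+\|\varphi_2'\|_{L^p(\mathbb D)}\big)\Big(\big[\operatorname{meas}\varphi_1(\mathbb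 D^+)-\operatorname{meas}\varphi_2(\mathbb D^+)\big]+\big[\operatorname{meas}\varphi_2(\mathbb D^-)-\operatorname{meas}\varphi_1(\mathbb D^-)\big]\Big)^{1/2}.$$ -/

import Mathlib

open MeasureTheory Set Metric
open scoped ENNReal ContDiff

noncomputable section

/-- The open unit disc of the complex plane. -/
def unitDisc : Set ℂ := ball (0 : ℂ) 1

/-- `φ` is a conformal mapping (conformal homeomorphism) of `U` onto `V`: it is holomorphic on `U`
and maps `U` bijectively onto `V`. -/
def IsConformalOnto (φ : ℂ → ℂ) (U V : Set ℂ) : Prop :=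
  DifferentiableOn ℂ φ U ∧ BijOn φ U V

/-- The Jacobian of `φ` as a map of the real plane. -/
def jacobian (φ : ℂ → ℂ) (z : ℂ) : ℝ := (fderiv ℝ φ z).det

/-- `C_0^∞(Ω)`, real-valued; the plane is `ℂ` as a real inner product space. -/
def IsTestFunction (Ω : Set ℂ) (u : ℂ → ℝ) : Prop :=
  ContDiff ℝ ∞ u ∧ HasCompactSupport u ∧ tsupport u ⊆ Ω

/-- `L²(Ω) × L²(Ω; ℝ²)` with the Hilbert norm `(‖f‖² + ‖G‖²)^{1/2}`; the plane `ℝ²`, in which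
gradients take their values, is `ℂ` with its real inner product. -/
abbrev L2Pairs (Ω : Set ℂ) : Type :=
  WithLp 2 (Lp ℝ 2 (volume.restrict Ω) × Lp ℂ 2 (volume.restrict Ω))

/-- `G` is the weak gradient of `f` in `Ω`: for every test function `v` and every direction `e`,
`∫_Ω f ∂_e v = - ∫_Ω (G · e) v`. -/
def HasWeakGradient (Ω : Set ℂ) (f : ℂ → ℝ) (G : ℂ → ℂ) : Prop :=
  ∀ v : ℂ → ℝ, IsTestFunction Ω v → ∀ e : ℂ,
    ∫ z in Ω, f z * fderiv ℝ v z e = - ∫ z in Ω, inner ℝ (G z) e * v z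

/-- The pairs `(u, ∇u)` with `u ∈ C_0^∞(Ω)`. -/
def testPairs (Ω : Set ℂ) : Set (L2Pairs Ω) :=
  {w | ∃ u : ℂ → ℝ, IsTestFunction Ω u ∧
    w.fst =ᵐ[volume.restrict Ω] u ∧ w.snd =ᵐ[volume.restrict Ω] gradient u}

/-- The Sobolev space `W_0^{1,2}(Ω)`: the closure of `C_0^∞(Ω)` in the `W^{1,2}`-norm. An element
`w` is a function `w.fst ∈ L²(Ω)` recorded together with its gradient `w.snd`, which is determined
by `w.fst` because it is its weak gradient, see `W012.hasWeakGradient`. -/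
def W012 (Ω : Set ℂ) : Submodule ℝ (L2Pairs Ω) :=
  (Submodule.span ℝ (testPairs Ω)).topologicalClosure

theorem IsTestFunction.memLp_smul {Ω : Set ℂ} {v : ℂ → ℝ} (hv : IsTestFunction Ω v) (e : ℂ) :
    MemLp (fun z => v z • e) 2 (volume.restrict Ω) :=
  (Continuous.memLp_of_hasCompactSupport (by have := hv.1.continuous; fun_prop)
    (hv.2.1.smul_right (f' := fun _ => e))).restrict Ω

theorem IsTestFunction.memLp_fderiv {Ω : Set ℂ} {v : ℂ → ℝ} (hv : IsTestFunction Ω v) (e : ℂ) :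
    MemLp (fun z => fderiv ℝ v z e) 2 (volume.restrict Ω) :=
  (Continuous.memLp_of_hasCompactSupport
    ((hv.1.continuous_fderiv (by simp)).clm_apply continuous_const)
    (hv.2.1.fderiv_apply ℝ e)).restrict Ω

theorem W012.hasWeakGradient {Ω : Set ℂ} {w : L2Pairs Ω} (hw : w ∈ W012 Ω) :
    HasWeakGradient Ω w.fst w.snd := by
  intro v hv e
  let a := (hv.memLp_fderiv e).toLp
  let b := (hv.memLp_smul e).toLp
  have h1 : ∀ w : L2Pairs Ω, ∫ z in Ω, w.fst z * fderiv ℝ v z e = inner ℝ w.fst a := by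
    intro w
    rw [L2.inner_def]
    refine integral_congr_ae ?_
    filter_upwards [(hv.memLp_fderiv e).coeFn_toLp] with z hz
    simp only [a, hz]
    simp [mul_comm]
  have h2 : ∀ w : L2Pairs Ω, ∫ z in Ω, inner ℝ (w.snd z) e * v z = inner ℝ w.snd b := by
    intro w
    rw [L2.inner_def]
    refine integral_congr_ae ?_
    filter_upwards [(hv.memLp_smul e).coeFn_toLp] with z hz
    simp only [b, hz]
    rw [real_inner_smul_right, mul_comm]
  rw [h1, h2]
  let K : Submodule ℝ (L2Pairs Ω) :=
    { carrier := {w | inner ℝ w.fst a = - inner ℝ w.snd b}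
      add_mem' := by
        intro x y hx hy
        simp only [mem_ofPred_eq] at *
        simp only [WithLp.add_fst, WithLp.add_snd, inner_add_left, hx, hy]; ring
      zero_mem' := by simp
      smul_mem' := by
        intro c x hx
        simp only [mem_ofPred_eq] at *
        simp only [WithLp.smul_fst, WithLp.smul_snd, real_inner_smul_left, hx]; ring }
  have hK : IsClosed (K : Set (L2Pairs Ω)) := by
    refine isClosed_eq ?_ ?_
    · exact Continuous.inner (WithLp.continuous_fst _ _ _) continuous_const
    · exact (Continuous.inner (WithLp.continuous_snd _ _ _) continuous_const).neg
  refine Submodule.topologicalClosure_minimal _ (t := K) ?_ hK hw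
  rw [Submodule.span_le]
  rintro w ⟨u, hu, hf, hg⟩
  change inner ℝ w.fst a = - inner ℝ w.snd b
  rw [← h1, ← h2]
  have e1 : ∫ z in Ω, w.fst z * fderiv ℝ v z e = ∫ z, u z * fderiv ℝ v z e := by
    rw [← setIntegral_eq_integral_of_forall_compl_eq_zero (s := Ω)
      (f := fun z => u z * fderiv ℝ v z e)]
    · refine integral_congr_ae ?_
      filter_upwards [hf] with z hz
      rw [hz]
    · intro z hz
      rw [image_eq_zero_of_notMem_tsupport (fun h => hz (hu.2.2 h)), zero_mul]
  have e2 : ∫ z in Ω, inner ℝ (w.snd z) e * v z = ∫ z, fderiv ℝ u z e * v z := by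
    rw [← setIntegral_eq_integral_of_forall_compl_eq_zero (s := Ω)
      (f := fun z => fderiv ℝ u z e * v z)]
    · refine integral_congr_ae ?_
      filter_upwards [hg] with z hz
      rw [hz, gradient, InnerProductSpace.toDual_symm_apply]
    · intro z hz
      rw [image_eq_zero_of_notMem_tsupport (fun h => hz (hv.2.2 h)), mul_zero]
  rw [e1, e2]
  have cu := hu.1.continuous
  have cv := hv.1.continuous
  have cdu : Continuous fun z => fderiv ℝ u z e :=
    (hu.1.continuous_fderiv (by simp)).clm_apply continuous_const
  have cdv : Continuous fun z => fderiv ℝ v z e :=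
    (hv.1.continuous_fderiv (by simp)).clm_apply continuous_const
  refine integral_mul_fderiv_eq_neg_fderiv_mul_of_integrable ?_ ?_ ?_ ?_ ?_
  · exact (cdu.mul cv).integrable_of_hasCompactSupport hv.2.1.mul_left
  · exact (cu.mul cdv).integrable_of_hasCompactSupport hu.2.1.mul_right
  · exact (cu.mul cv).integrable_of_hasCompactSupport hu.2.1.mul_right
  · exact fun x _ => hu.1.differentiable (by simp) x
  · exact fun x _ => hv.1.differentiable (by simp) x

/-- `u ∈ W_0^{1,2}(Ω)` is an eigenfunction of the Dirichlet Laplacian in `Ω` with eigenvalue `μ`: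
`u ≠ 0` and `∫_Ω ∇u · ∇v = μ ∫_Ω u v` for all `v ∈ W_0^{1,2}(Ω)`. The inner products are those of
`L²(Ω; ℝ²)` and `L²(Ω)`. -/
def IsDirichletEigenfunction (Ω : Set ℂ) (μ : ℝ) (u : W012 Ω) : Prop :=
  u ≠ 0 ∧ ∀ v : W012 Ω, inner ℝ u.1.snd v.1.snd = μ * inner ℝ u.1.fst v.1.fst

/-- The levels `t` such that the Dirichlet Laplacian in `Ω` has, counted with multiplicity, at least
`n` eigenvalues in `(-∞, t]`. -/
def dirichletLevels (Ω : Set ℂ) (n : ℕ) : Set ℝ :=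
  {t | ∃ u : Fin n → W012 Ω, LinearIndependent ℝ u ∧
    ∀ i, ∃ μ ≤ t, IsDirichletEigenfunction Ω μ (u i)}

/-- `λ_n[Ω]`, `n ≥ 1`: the `n`-th eigenvalue of the Dirichlet Laplacian in `Ω`, in non-decreasing
order and repeated according to multiplicity. -/
def dirichletEigenvalue (Ω : Set ℂ) (n : ℕ) : ℝ := sInf (dirichletLevels Ω n)

/-- `C(q)`: the best constant in `‖f‖_{L^q(𝔻)} ≤ C ‖∇f‖_{L²(𝔻)}`, `f ∈ W_0^{1,2}(𝔻)`. -/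
def sobolevConst (q : ℝ≥0∞) : ℝ :=
  sInf {C : ℝ | 0 ≤ C ∧ ∀ f : W012 unitDisc,
    eLpNorm f.1.fst q (volume.restrict unitDisc) ≤ ENNReal.ofReal (C * ‖f.1.snd‖)}

/-- The exponent `4p/(p-2)`, read as its limit `4` for `p = ∞`. -/
def sobolevExponent (p : ℝ≥0∞) : ℝ≥0∞ := if p = ⊤ then 4 else 4 * p / (p - 2)

/-- The norm of `L^p(𝔻)`, as a real number. -/
def discNorm {E : Type*} [NormedAddCommGroup E] (g : ℂ → E) (p : ℝ≥0∞) : ℝ :=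
  (eLpNorm g p (volume.restrict unitDisc)).toReal

/-- `𝔻⁺ = {z ∈ 𝔻 : J_{φ₁}(z) ≥ J_{φ₂}(z)}`. -/
def discPlus (φ₁ φ₂ : ℂ → ℂ) : Set ℂ := {z ∈ unitDisc | jacobian φ₂ z ≤ jacobian φ₁ z}

/-- `𝔻⁻ = {z ∈ 𝔻 : J_{φ₁}(z) < J_{φ₂}(z)}`. -/
def discMinus (φ₁ φ₂ : ℂ → ℂ) : Set ℂ := {z ∈ unitDisc | jacobian φ₁ z < jacobian φ₂ z}

end

/-! The Dirichlet integral in the plane is conformally invariant. Composition with `φ` therefore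
identifies `W012 Ω` with the Sobolev space of the disc: the gradient pairing is unchanged, and `∫_Ω
u v` becomes `∫_𝔻 |φ'|² u v`. Both eigenvalue problems thus live on one Hilbert space, the space
`DiscGradients` of gradients with the L² norm, and read `g = μ T g` with `T = J† J`, where `J` sends
`∇u` to `|φ'| u` (`IsWeightedBy.exists_equiv`, `dirichletLevels_eq_spectralLevels`).

Each `T` is symmetric, positive and compact. Compactness comes from the Rellich theorem on the disc
and the approximation of `|φ'|` by bounded weights, the Sobolev inequality making `J` depend
continuously on the weight. So the eigenvalues exist, and their reciprocals obey a min-max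
principle, whence Weyl's inequality: `|1/λ_n[Ω₁] - 1/λ_n[Ω₂]|` is at most any bound of the
difference of the two quadratic forms on unit vectors (`inv_sInf_spectralLevels_sub_le`).

That difference is `∫ (|φ₁'| - |φ₂'|)(|φ₁'| + |φ₂'|) u²`. Hölder's inequality with exponents 2, p,
q, q, where `1/2 + 1/p + 2/q = 1`, that is `q = 4p/(p-2)`, and the Sobolev inequality bound it
(`inner_self_sub_inner_self_le`). Multiplying by `λ_n[Ω₁] λ_n[Ω₂] ≤ c_n` gives the first estimate.
The second follows from `(a - b)² ≤ |a² - b²|` for `a, b ≥ 0`, since `|φ'|²` is the Jacobian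
(`discNorm_sub_le_sqrt`). -/

/-! ### Min-max principle and Weyl's inequality for compact positive operators. -/

section SpectralLevels

open Module.End

variable {V : Type*} [NormedAddCommGroup V] [InnerProductSpace ℝ V]

/-- The levels `t` such that `u = μ T u` has, counted with multiplicity, at least `n` characteristic
values `μ ≤ t`. -/
def spectralLevels (T : V →L[ℝ] V) (n : ℕ) : Set ℝ :=
  {t | ∃ u : Fin n → V, LinearIndependent ℝ u ∧ ∀ i, ∃ μ ≤ t, u i = μ • T (u i)}

/-- The vectors in eigenspaces of `T` for eigenvalues at least `c`. -/
def highEigenvectors (T : V →L[ℝ] V) (c : ℝ) : Set V := {x | ∃ ν, c ≤ ν ∧ T x = ν • x}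

theorem mem_spectralLevels_of_highEigenvectors {T : V →L[ℝ] V} {c : ℝ} (hc : 0 < c) {n : ℕ}
    {u : Fin n → V} (hu : LinearIndependent ℝ u) (h : ∀ i, u i ∈ highEigenvectors T c) :
    c⁻¹ ∈ spectralLevels T n := by
  refine ⟨u, hu, fun i => ?_⟩
  obtain ⟨ν, hν, h⟩ := h i
  refine ⟨ν⁻¹, by gcongr, ?_⟩
  rw [h, smul_smul, inv_mul_cancel₀ (hc.trans_le hν).ne', one_smul]

/-- On the span of eigenvectors for eigenvalues at least `c` the quadratic form is at least `c`. -/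
theorem le_inner_of_mem_span_highEigenvectors {T : V →L[ℝ] V} (hT : T.IsSymmetric) {c : ℝ} {x : V}
    (hx : x ∈ Submodule.span ℝ (highEigenvectors T c)) :
    c * ‖x‖ ^ 2 ≤ inner ℝ (T x) x := by
  have hx' : x ∈ ⨆ ν : {ν : ℝ // c ≤ ν}, eigenspace (T : V →ₗ[ℝ] V) ν := by
    refine (Submodule.span_le.2 ?_) hx
    rintro y ⟨ν, hν, hy⟩
    exact (le_iSup (fun ν : {ν : ℝ // c ≤ ν} => eigenspace (T : V →ₗ[ℝ] V) ν) ⟨ν, hν⟩)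
      (mem_eigenspace_iff.2 hy)
  obtain ⟨f, hf, rfl⟩ := (Submodule.mem_iSup_iff_exists_finsupp _ _).1 hx'
  have horth : ∀ i j, i ≠ j → inner ℝ (f i) (f j) = 0 := fun i j hij =>
    hT.orthogonalFamily_eigenspaces.pairwise (fun h => hij (Subtype.ext h).symm) (hf j) _ (hf i)
  have h1 : ∀ i, T (f i) = (i : ℝ) • f i := fun i => mem_eigenspace_iff.1 (hf i)
  -- Distinct eigenspaces are orthogonal, so the form is diagonal. It is used with `a = 1` for the
  -- norm and with `a = ν` for the quadratic form.
  have key : ∀ a : {ν : ℝ // c ≤ ν} → ℝ,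
      inner ℝ (∑ i ∈ f.support, a i • f i) (∑ i ∈ f.support, f i) =
        ∑ i ∈ f.support, a i * ‖f i‖ ^ 2 := by
    intro a
    rw [sum_inner]
    refine Finset.sum_congr rfl fun i hi => ?_
    rw [inner_sum, Finset.sum_eq_single_of_mem i hi]
    · rw [real_inner_smul_left, real_inner_self_eq_norm_sq]
    · intro j _ hj
      rw [real_inner_smul_left, horth i j hj.symm, mul_zero]
  have e1 := key fun _ => 1
  simp only [one_smul, one_mul, real_inner_self_eq_norm_sq] at e1
  change c * ‖∑ i ∈ f.support, f i‖ ^ 2 ≤ inner ℝ (T (∑ i ∈ f.support, f i)) (∑ i ∈ f.support, f i)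
  rw [map_sum, Finset.sum_congr rfl fun i _ => h1 i, key (fun i => i), e1, Finset.mul_sum]
  exact Finset.sum_le_sum fun i _ => by gcongr; exact i.2

/-- If `‖T‖` were in the resolvent set, the Rayleigh quotient would stay below `‖T‖ - ε`; but for a
positive symmetric operator its supremum is `‖T‖`. -/
theorem norm_mem_spectrum_of_nonneg [Nontrivial V] {T : V →L[ℝ] V} (hT : T.IsSymmetric)
    (hpos : ∀ x, 0 ≤ inner ℝ (T x) x) : ‖T‖ ∈ spectrum ℝ T := by
  by_contra h
  obtain ⟨ε, hε, hx⟩ := T.rayleighQuotient_le_of_norm_mem_resolventSet (by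
    simpa [spectrum] using h)
  have : ‖T‖ ≤ ‖T‖ - ε := by
    conv_lhs => rw [T.norm_eq_iSup_rayleighQuotient hT]
    refine ciSup_le fun x => ?_
    rw [abs_of_nonneg]
    · exact hx x
    · exact div_nonneg (by simpa [ContinuousLinearMap.reApplyInnerSelf_apply] using hpos x)
        (by positivity)
  linarith

/-- The easy half of min-max: the subspace is the span of the `n` eigenvectors, whose eigenvalues
`μ⁻¹` are at least `t⁻¹`. -/
theorem exists_finrank_eq_of_mem_spectralLevels {T : V →L[ℝ] V} (hT : T.IsSymmetric)
    (hpos : ∀ x ≠ 0, 0 < inner ℝ (T x) x) {n : ℕ} {t : ℝ} (ht : t ∈ spectralLevels T n) :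
    ∃ E : Submodule ℝ V, Module.finrank ℝ E = n ∧ ∀ x ∈ E, t⁻¹ * ‖x‖ ^ 2 ≤ inner ℝ (T x) x := by
  obtain ⟨u, hu, h⟩ := ht
  refine ⟨Submodule.span ℝ (range u), by simpa using finrank_span_eq_card hu, fun x hx => ?_⟩
  refine le_inner_of_mem_span_highEigenvectors hT (Submodule.span_mono ?_ hx)
  rintro _ ⟨i, rfl⟩
  obtain ⟨μ, hμ, hi⟩ := h i
  have hμ0 : 0 < μ := by
    have h1 := hpos (u i) (hu.ne_zero i)
    have h2 : inner ℝ (u i) (u i) = μ * inner ℝ (T (u i)) (u i) := by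
      conv_lhs => rw [hi]
      rw [real_inner_smul_left, ← hi]
    have h3 : 0 < inner ℝ (u i) (u i) := real_inner_self_pos.2 (hu.ne_zero i)
    rw [h2] at h3
    exact pos_of_mul_pos_left h3 h1.le
  refine ⟨μ⁻¹, by gcongr, ?_⟩
  conv_rhs => rw [hi]
  rw [smul_smul, inv_mul_cancel₀ hμ0.ne', one_smul]

/-- An eigenvalue `μ⁻¹` of `T` cannot exceed `‖T‖`. This bounds the levels away from zero, so their
infimum is positive. -/
theorem inv_norm_le_of_mem_spectralLevels {T : V →L[ℝ] V}
    (hpos : ∀ x ≠ 0, 0 < inner ℝ (T x) x) {n : ℕ} (hn : 1 ≤ n) {t : ℝ}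
    (ht : t ∈ spectralLevels T n) : 0 < ‖T‖⁻¹ ∧ ‖T‖⁻¹ ≤ t := by
  obtain ⟨u, hu, h⟩ := ht
  obtain ⟨μ, hμ, hi⟩ := h ⟨0, hn⟩
  have hne := hu.ne_zero ⟨0, hn⟩
  set x := u ⟨0, hn⟩
  have h1 := hpos x hne
  have h2 : inner ℝ x x = μ * inner ℝ (T x) x := by
    conv_lhs => rw [hi]
    rw [real_inner_smul_left, ← hi]
  have h3 : inner ℝ (T x) x ≤ ‖T‖ * ‖x‖ ^ 2 :=
    (real_inner_le_norm _ _).trans (by rw [pow_two, ← mul_assoc]; gcongr; exact T.le_opNorm _)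
  have hx : 0 < ‖x‖ ^ 2 := by positivity
  have hT0 : 0 < ‖T‖ := pos_of_mul_pos_left (h1.trans_le h3) hx.le
  refine ⟨by positivity, le_trans ?_ hμ⟩
  rw [real_inner_self_eq_norm_sq] at h2
  rw [inv_le_iff_one_le_mul₀ hT0]
  have hμ0 : 0 < μ := pos_of_mul_pos_left (h2 ▸ hx) h1.le
  have : ‖x‖ ^ 2 ≤ μ * (‖T‖ * ‖x‖ ^ 2) := h2.le.trans (by gcongr)
  nlinarith

variable [CompleteSpace V]

/-- Either there are `n` independent eigenvectors for eigenvalues at least `c`, or on every subspace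
of dimension `n` the Rayleigh quotient takes a value at most `d`, with `d < c` uniform. -/
theorem mem_spectralLevels_or {T : V →L[ℝ] V} (hT : T.IsSymmetric) (hc : IsCompactOperator T)
    (hpos : ∀ x, 0 ≤ inner ℝ (T x) x) {c : ℝ} (hc0 : 0 < c) (n : ℕ) :
    c⁻¹ ∈ spectralLevels T n ∨ ∃ d < c, ∀ E : Submodule ℝ V, Module.finrank ℝ E = n →
      ∃ x ∈ E, x ≠ 0 ∧ inner ℝ (T x) x ≤ d * ‖x‖ ^ 2 := by
  -- `b` is a basis of the span of the high eigenvectors, chosen among them. Either it has `n`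
  -- elements, or the span `F` has dimension less than `n`.
  obtain ⟨b, hb, hspan, hli⟩ := exists_linearIndependent ℝ (highEigenvectors T c)
  by_cases hn : (n : Cardinal) ≤ Cardinal.mk b
  · left
    obtain ⟨e⟩ : Nonempty (Fin n ↪ b) := by
      rw [← Cardinal.lift_mk_le']
      simpa using hn
    exact mem_spectralLevels_of_highEigenvectors hc0 (hli.comp e e.injective)
      fun i => hb (e i).2
  right
  push Not at hn
  set F := Submodule.span ℝ (highEigenvectors T c) with hF
  have hbf : Finite b := Cardinal.lt_aleph0_iff_finite.1 (hn.trans (Cardinal.natCast_lt_aleph0))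
  have hFfin : FiniteDimensional ℝ F := by
    rw [← hspan]
    exact FiniteDimensional.span_of_finite ℝ hbf
  have hFn : Module.finrank ℝ F < n := by
    rw [← hspan]
    have : Fintype b := Fintype.ofFinite b
    have h := finrank_span_eq_card hli
    rw [Subtype.range_coe] at h
    rw [h]
    rw [Cardinal.mk_fintype] at hn
    exact_mod_cast hn
  have hTF : ∀ x ∈ F, T x ∈ F := by
    intro x hx
    induction hx using Submodule.span_induction with
    | mem x hx =>
      obtain ⟨ν, hν, h⟩ := hx
      rw [h]
      exact F.smul_mem _ (Submodule.subset_span ⟨ν, hν, h⟩)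
    | zero => simp
    | add x y _ _ hx hy => rw [map_add]; exact F.add_mem hx hy
    | smul a x _ hx => rw [map_smul]; exact F.smul_mem _ hx
  have hTF' : ∀ x ∈ Fᗮ, T x ∈ Fᗮ := by
    intro x hx y hy
    have := hT y x
    simp only [ContinuousLinearMap.coe_coe] at this
    rw [← this]
    exact hx _ (hTF y hy)
  -- The uniform constant `d` is the norm of the part of `T` in `Fᗮ`, which is invariant because `T`
  -- is symmetric.
  let R : Fᗮ →L[ℝ] Fᗮ := T.restrict hTF'
  have hRc : IsCompactOperator R := hc.restrict' hTF'
  have hRs : R.IsSymmetric := hT.restrict_invariant hTF'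
  have hRpos : ∀ x, 0 ≤ inner ℝ (R x) x := fun x => hpos x
  have hRlt : ‖R‖ < c := by
    by_contra! hcR
    have hR0 : ‖R‖ ≠ 0 := (hc0.trans_le hcR).ne'
    have : Nontrivial Fᗮ := by
      by_contra hnt
      rw [not_nontrivial_iff_subsingleton] at hnt
      exact hR0 (le_antisymm (R.opNorm_le_bound le_rfl fun x => by
        rw [Subsingleton.elim (R x) 0]; simp) R.opNorm_nonneg)
    -- By compactness `‖R‖ ≥ c` would be an eigenvalue of `R`; its eigenvector would lie in `F` as
    -- well as in `Fᗮ`.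
    have hmem := norm_mem_spectrum_of_nonneg hRs hRpos
    obtain ⟨y, hy⟩ := ((hRc.hasEigenvalue_iff_mem_spectrum hR0).2 hmem).exists_hasEigenvector
    have hyT : T y = ‖R‖ • (y : V) := congrArg Subtype.val hy.apply_eq_smul
    have hyF : (y : V) ∈ F := Submodule.subset_span ⟨_, hcR, hyT⟩
    have : inner ℝ (y : V) (y : V) = 0 := y.2 _ hyF
    exact hy.2 (Subtype.ext (inner_self_eq_zero.1 this))
  refine ⟨‖R‖, hRlt, fun E hE => ?_⟩
  have hEfin : FiniteDimensional ℝ E := FiniteDimensional.of_finrank_pos (by omega)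
  -- Since `dim E = n > dim F`, the projection to `F` kills a nonzero vector of `E`.
  let q : E →ₗ[ℝ] F := (F.orthogonalProjectionOnto : V →ₗ[ℝ] F) ∘ₗ E.subtype
  obtain ⟨x, hx, hx0⟩ := (Submodule.ne_bot_iff _).1
    (LinearMap.ker_ne_bot_of_finrank_lt (f := q) (by omega))
  have hxF : (x : V) ∈ Fᗮ := by
    rw [LinearMap.mem_ker] at hx
    exact F.orthogonalProjectionOnto_eq_zero_iff.1 hx
  refine ⟨x, x.2, fun h => hx0 (Subtype.ext h), ?_⟩
  calc inner ℝ (T x) (x : V) = inner ℝ (R ⟨x, hxF⟩) ⟨x, hxF⟩ := rfl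
    _ ≤ ‖R ⟨x, hxF⟩‖ * ‖(⟨x, hxF⟩ : Fᗮ)‖ := real_inner_le_norm _ _
    _ ≤ ‖R‖ * ‖(⟨x, hxF⟩ : Fᗮ)‖ * ‖(⟨x, hxF⟩ : Fᗮ)‖ := by gcongr; exact R.le_opNorm _
    _ = ‖R‖ * ‖(x : V)‖ ^ 2 := by rw [pow_two, mul_assoc]; rfl

/-- Characteristic values of a compact positive definite operator exist. -/
theorem isLeast_spectralLevels {T : V →L[ℝ] V} (hT : T.IsSymmetric) (hc : IsCompactOperator T)
    (hpos : ∀ x ≠ 0, 0 < inner ℝ (T x) x) {n : ℕ} (hn : 1 ≤ n)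
    (hV : ∃ E : Submodule ℝ V, Module.finrank ℝ E = n) :
    IsLeast (spectralLevels T n) (sInf (spectralLevels T n)) ∧ 0 < sInf (spectralLevels T n) := by
  have hpos' : ∀ x, 0 ≤ inner ℝ (T x) x := fun x => by
    rcases eq_or_ne x 0 with rfl | hx
    · simp
    · exact (hpos x hx).le
  have hne : (spectralLevels T n).Nonempty := by
    obtain ⟨E, hE⟩ := hV
    have hEfin : FiniteDimensional ℝ E := FiniteDimensional.of_finrank_pos (by omega)
    have hnt : Nontrivial E := Module.nontrivial_of_finrank_pos (R := ℝ) (by omega)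
    -- The minimum `c` of the form on the unit sphere of a space of dimension `n` rules out the
    -- second alternative of `mem_spectralLevels_or`.
    obtain ⟨y, hy, hmin⟩ := (isCompact_sphere (0 : E) 1).exists_isMinOn
      (NormedSpace.sphere_nonempty.2 zero_le_one)
      (f := fun x : E => inner ℝ (T x) (x : V)) (by fun_prop)
    have hy1 : ‖y‖ = 1 := by simpa using hy
    have hyne : (y : V) ≠ 0 := fun h => by
      have : y = 0 := Subtype.ext h
      rw [this, norm_zero] at hy1
      exact zero_ne_one hy1
    set c := inner ℝ (T y) (y : V)
    have hc0 : 0 < c := hpos _ hyne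
    rcases mem_spectralLevels_or hT hc hpos' hc0 n with h | ⟨d, hd, h⟩
    · exact ⟨_, h⟩
    obtain ⟨x, hxE, hx0, hx⟩ := h E hE
    have hxn : 0 < ‖x‖ := norm_pos_iff.2 hx0
    have h1 : c ≤ inner ℝ (T (‖x‖⁻¹ • x)) (‖x‖⁻¹ • x) := by
      refine hmin (show (‖x‖⁻¹ • (⟨x, hxE⟩ : E)) ∈ sphere (0 : E) 1 from ?_)
      simp [norm_smul, hxn.ne']
    rw [map_smul, real_inner_smul_left, real_inner_smul_right] at h1
    have h2 : ‖x‖⁻¹ * (‖x‖⁻¹ * inner ℝ (T x) x) ≤ d := by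
      rw [← mul_assoc, ← mul_inv, ← pow_two, inv_mul_le_iff₀ (by positivity), mul_comm]
      exact hx
    linarith
  have hlow := fun t (ht : t ∈ spectralLevels T n) => inv_norm_le_of_mem_spectralLevels hpos hn ht
  have hbdd : BddBelow (spectralLevels T n) := ⟨_, fun t ht => (hlow t ht).2⟩
  have hl0 : 0 < sInf (spectralLevels T n) := by
    obtain ⟨t, ht⟩ := hne
    exact (hlow t ht).1.trans_le (le_csInf ⟨t, ht⟩ fun t ht => (hlow t ht).2)
  refine ⟨⟨?_, fun t ht => csInf_le hbdd ht⟩, hl0⟩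
  set l := sInf (spectralLevels T n)
  -- The infimum is attained because the gap `d < l⁻¹` is uniform: a level `t` near `l` has `t⁻¹ >
  -- d`, and its eigenvectors span a space on which the form exceeds `d ‖x‖²`.
  rcases mem_spectralLevels_or hT hc hpos' (inv_pos.2 hl0) n with h | ⟨d, hd, h⟩
  · rwa [inv_inv] at h
  exfalso
  obtain ⟨t, ht, htd⟩ : ∃ t ∈ spectralLevels T n, d < t⁻¹ := by
    by_cases hd0 : d ≤ 0
    · obtain ⟨t, ht⟩ := hne
      exact ⟨t, ht, hd0.trans_lt (inv_pos.2 ((hlow t ht).1.trans_le (hlow t ht).2))⟩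
    push Not at hd0
    obtain ⟨t, ht, h⟩ := exists_lt_of_csInf_lt hne (show l < d⁻¹ from (lt_inv_comm₀ hd0 hl0).1 hd)
    exact ⟨t, ht, (lt_inv_comm₀ hd0 ((hlow t ht).1.trans_le (hlow t ht).2)).2 h⟩
  obtain ⟨E, hE, hEx⟩ := exists_finrank_eq_of_mem_spectralLevels hT hpos ht
  obtain ⟨x, hxE, hx0, hx⟩ := h E hE
  have h1 := (hEx x hxE).trans hx
  have h2 : 0 < ‖x‖ ^ 2 := by positivity
  exact absurd (le_of_mul_le_mul_right h1 h2) (not_le.2 htd)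

/-- Weyl's inequality. On the span of `n` eigenvectors of `T₁` its form is at least `a⁻¹`, so that
of `T₂` is at least `a⁻¹ - δ`; hence `T₂` has `n` independent eigenvectors for eigenvalues at least
`a⁻¹ - δ`, if this is positive. -/
theorem inv_sInf_spectralLevels_sub_le {T₁ T₂ : V →L[ℝ] V} (hT₁ : T₁.IsSymmetric)
    (hT₂ : T₂.IsSymmetric) (hc₁ : IsCompactOperator T₁) (hc₂ : IsCompactOperator T₂)
    (hpos₁ : ∀ x ≠ 0, 0 < inner ℝ (T₁ x) x) (hpos₂ : ∀ x ≠ 0, 0 < inner ℝ (T₂ x) x)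
    {n : ℕ} (hn : 1 ≤ n) (hV : ∃ E : Submodule ℝ V, Module.finrank ℝ E = n) {δ : ℝ}
    (hδ : ∀ x, inner ℝ (T₁ x) x - inner ℝ (T₂ x) x ≤ δ * ‖x‖ ^ 2) :
    (sInf (spectralLevels T₁ n))⁻¹ - (sInf (spectralLevels T₂ n))⁻¹ ≤ δ := by
  obtain ⟨⟨hm₁, -⟩, h0₁⟩ := isLeast_spectralLevels hT₁ hc₁ hpos₁ hn hV
  obtain ⟨⟨hm₂, hl₂⟩, h0₂⟩ := isLeast_spectralLevels hT₂ hc₂ hpos₂ hn hV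
  set a := sInf (spectralLevels T₁ n)
  set b := sInf (spectralLevels T₂ n)
  by_contra! hlt
  have hb := inv_pos.2 h0₂
  have hc0 : 0 < a⁻¹ - δ := by linarith
  have hpos' : ∀ x, 0 ≤ inner ℝ (T₂ x) x := fun x => by
    rcases eq_or_ne x 0 with rfl | hx
    · simp
    · exact (hpos₂ x hx).le
  rcases mem_spectralLevels_or hT₂ hc₂ hpos' hc0 n with h | ⟨d, hd, h⟩
  · have h2 := hl₂ h
    have h3 := (le_inv_comm₀ h0₂ hc0).1 h2
    linarith
  · obtain ⟨E, hE, hEx⟩ := exists_finrank_eq_of_mem_spectralLevels hT₁ hpos₁ hm₁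
    obtain ⟨x, hxE, hx0, hx⟩ := h E hE
    have h1 := hEx x hxE
    have h2 := hδ x
    have h3 : 0 < ‖x‖ ^ 2 := by positivity
    nlinarith

end SpectralLevels

/-! ### Injective holomorphic maps and composition with them. -/

section Conformal

open Filter Topology Function

/-- The open mapping theorem: injectivity excludes the locally constant case, since no point of the
plane is isolated. -/
theorem Complex.nhds_le_map_of_injOn {f : ℂ → ℂ} {U : Set ℂ} (hU : IsOpen U)
    (hf : DifferentiableOn ℂ f U) (hinj : InjOn f U) {z : ℂ} (hz : z ∈ U) :
    𝓝 (f z) ≤ map f (𝓝 z) := by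
  have ha : AnalyticAt ℂ f z := hf.analyticAt (hU.mem_nhds hz)
  refine ha.eventually_constant_or_nhds_le_map_nhds.resolve_left fun h => ?_
  have h1 : ∀ᶠ w in 𝓝 z, w = z := by
    filter_upwards [h, hU.mem_nhds hz] with w hw hwU using hinj hwU hz hw
  have h2 : ∀ᶠ w in 𝓝[≠] z, w = z := h1.filter_mono nhdsWithin_le_nhds
  obtain ⟨w, hw, hw'⟩ := (h2.and self_mem_nhdsWithin).exists
  exact hw' hw

theorem Complex.continuousAt_invFunOn {f : ℂ → ℂ} {U : Set ℂ} (hU : IsOpen U)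
    (hf : DifferentiableOn ℂ f U) (hinj : InjOn f U) {z : ℂ} (hz : z ∈ U) :
    ContinuousAt (invFunOn f U) (f z) := by
  intro N hN
  rw [hinj.leftInvOn_invFunOn hz] at hN
  have h1 := Complex.nhds_le_map_of_injOn hU hf hinj hz
    (image_mem_map (inter_mem hN (hU.mem_nhds hz)))
  change invFunOn f U ⁻¹' N ∈ 𝓝 (f z)
  refine mem_of_superset h1 ?_
  rintro _ ⟨w, ⟨hwN, hwU⟩, rfl⟩
  rwa [mem_preimage, hinj.leftInvOn_invFunOn hwU]

theorem Complex.eventually_invFunOn_eq {f : ℂ → ℂ} {U : Set ℂ} (hU : IsOpen U)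
    (hf : DifferentiableOn ℂ f U) (hinj : InjOn f U) {z : ℂ} (hz : z ∈ U) :
    ∀ᶠ w in 𝓝 (f z), f (invFunOn f U w) = w := by
  filter_upwards [Complex.nhds_le_map_of_injOn hU hf hinj hz (image_mem_map (hU.mem_nhds hz))]
    with w hw
  exact invFunOn_eq hw

theorem Complex.hasDerivAt_invFunOn {f : ℂ → ℂ} {U : Set ℂ} (hU : IsOpen U)
    (hf : DifferentiableOn ℂ f U) (hinj : InjOn f U) {z : ℂ} (hz : z ∈ U) (h : deriv f z ≠ 0) :
    HasDerivAt (invFunOn f U) (deriv f z)⁻¹ (f z) := by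
  refine HasDerivAt.of_local_left_inverse (Complex.continuousAt_invFunOn hU hf hinj hz) ?_ h
    (Complex.eventually_invFunOn_eq hU hf hinj hz)
  rw [hinj.leftInvOn_invFunOn hz]
  exact (hf.differentiableAt (hU.mem_nhds hz)).hasDerivAt

/-- An injective holomorphic function has no critical points. -/
theorem Complex.deriv_ne_zero_of_injOn {f : ℂ → ℂ} {U : Set ℂ} (hU : IsOpen U)
    (hf : DifferentiableOn ℂ f U) (hinj : InjOn f U) {z : ℂ} (hz : z ∈ U) : deriv f z ≠ 0 := by
  have hUz := hU.mem_nhds hz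
  have ha : AnalyticAt ℂ (deriv f) z := (hf.analyticAt hUz).deriv
  rcases ha.eventually_eq_zero_or_eventually_ne_zero with h | h
  -- If `f'` vanishes near `z`, then `f` is constant on a ball, against injectivity.
  · exfalso
    obtain ⟨r, hr, hrU⟩ := Metric.mem_nhds_iff.1 (inter_mem h hUz)
    have hconst := fun w hw => (convex_ball z r).is_const_of_fderivWithin_eq_zero (𝕜 := ℂ)
      (hf.mono fun w hw => (hrU hw).2) (fun w hw => by
        rw [fderivWithin_of_isOpen isOpen_ball hw]
        ext
        simpa using (hrU hw).1) (x := w) (y := z) hw (mem_ball_self hr)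
    obtain ⟨w, hw, hw'⟩ := ((Filter.Eventually.filter_mono (nhdsWithin_le_nhds (s := {z}ᶜ))
      (ball_mem_nhds z hr)).and self_mem_nhdsWithin).exists
    exact hw' (hinj (hrU hw).2 hz (hconst w hw))
  -- Otherwise zeros of `f'` are isolated, so the inverse is holomorphic in a punctured
  -- neighbourhood of `f z` and continuous at `f z`. The singularity is removable, and the chain
  -- rule for the inverse composed with `f` forbids `f' z = 0`.
  · have hd : ∀ᶠ w in 𝓝[≠] (f z), DifferentiableAt ℂ (invFunOn f U) w := by
      have h' : ∀ᶠ w in 𝓝 z, w ≠ z → deriv f w ≠ 0 := eventually_nhdsWithin_iff.1 h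
      rw [eventually_nhdsWithin_iff]
      filter_upwards [Complex.nhds_le_map_of_injOn hU hf hinj hz (image_mem_map (inter_mem h' hUz))]
      rintro _ ⟨w, ⟨hw, hwU⟩, rfl⟩ hne
      exact (Complex.hasDerivAt_invFunOn hU hf hinj hwU
        (hw fun h => hne (by rw [h]; rfl))).differentiableAt
    have hg := (Complex.analyticAt_of_differentiable_on_punctured_nhds_of_continuousAt hd
      (Complex.continuousAt_invFunOn hU hf hinj hz)).differentiableAt
    have hcomp := hg.hasDerivAt.comp z (hf.differentiableAt hUz).hasDerivAt
    have hid : HasDerivAt (invFunOn f U ∘ f) 1 z := (hasDerivAt_id z).congr_of_eventuallyEq (by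
      filter_upwards [hUz] with w hw using hinj.leftInvOn_invFunOn hw)
    intro h0
    have := hcomp.unique hid
    rw [h0, mul_zero] at this
    exact zero_ne_one this

theorem IsConformalOnto.isOpen {φ : ℂ → ℂ} {U V : Set ℂ} (hU : IsOpen U)
    (h : IsConformalOnto φ U V) : IsOpen V := by
  rw [← h.2.image_eq, isOpen_iff_mem_nhds]
  rintro _ ⟨z, hz, rfl⟩
  exact Complex.nhds_le_map_of_injOn hU h.1 h.2.injOn hz (image_mem_map (hU.mem_nhds hz))

theorem IsConformalOnto.deriv_ne_zero {φ : ℂ → ℂ} {U V : Set ℂ} (hU : IsOpen U)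
    (h : IsConformalOnto φ U V) {z : ℂ} (hz : z ∈ U) : deriv φ z ≠ 0 :=
  Complex.deriv_ne_zero_of_injOn hU h.1 h.2.injOn hz

theorem IsConformalOnto.symm {φ : ℂ → ℂ} {U V : Set ℂ} (hU : IsOpen U)
    (h : IsConformalOnto φ U V) : IsConformalOnto (invFunOn φ U) V U := by
  refine ⟨?_, h.2.symm h.2.invOn_invFunOn.symm⟩
  intro w hw
  rw [← h.2.image_eq] at hw
  obtain ⟨z, hz, rfl⟩ := hw
  exact (Complex.hasDerivAt_invFunOn hU h.1 h.2.injOn hz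
    (h.deriv_ne_zero hU hz)).differentiableAt.differentiableWithinAt

/-- The indicator is needed because nothing is known of `φ` outside `U`. The support stays compact
in `U` as it lies in the image of `tsupport u` under the continuous inverse. -/
theorem IsTestFunction.comp_conformal {φ : ℂ → ℂ} {U V : Set ℂ} (hU : IsOpen U)
    (h : IsConformalOnto φ U V) {u : ℂ → ℝ} (hu : IsTestFunction V u) :
    IsTestFunction U (U.indicator (u ∘ φ)) := by
  have hsymm := h.symm hU
  have hK : IsCompact (invFunOn φ U '' tsupport u) :=
    hu.2.1.isCompact.image_of_continuousOn (hsymm.1.continuousOn.mono hu.2.2)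
  have hKU : invFunOn φ U '' tsupport u ⊆ U := by
    rintro _ ⟨w, hw, rfl⟩
    exact hsymm.2.mapsTo (hu.2.2 hw)
  have hsupp : tsupport (U.indicator (u ∘ φ)) ⊆ invFunOn φ U '' tsupport u := by
    refine closure_minimal ?_ hK.isClosed
    intro z hz
    have hzU : z ∈ U := by
      by_contra hzU
      exact hz (indicator_of_notMem hzU _)
    rw [mem_support, indicator_of_mem hzU] at hz
    exact ⟨φ z, subset_tsupport _ hz, h.2.invOn_invFunOn.1 hzU⟩
  refine ⟨?_, hK.of_isClosed_subset (isClosed_tsupport _) hsupp, hsupp.trans hKU⟩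
  refine contDiff_iff_contDiffAt.2 fun z => ?_
  by_cases hz : z ∈ tsupport (U.indicator (u ∘ φ))
  swap
  · exact contDiffAt_const.congr_of_eventuallyEq (notMem_tsupport_iff_eventuallyEq.1 hz)
  have hzU := hKU (hsupp hz)
  have hφ : ContDiffAt ℝ ∞ φ z :=
    ((h.1.analyticAt (hU.mem_nhds hzU)).contDiffAt (n := ∞)).restrict_scalars ℝ
  refine (hu.1.contDiffAt.comp z hφ).congr_of_eventuallyEq ?_
  filter_upwards [hU.mem_nhds hzU] with w hw using indicator_of_mem hw _

/-- Gradients transform by the adjoint of the derivative, and the real adjoint of multiplication by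
`φ'` is multiplication by its conjugate. -/
theorem gradient_indicator_comp_conformal {φ : ℂ → ℂ} {U : Set ℂ} (hU : IsOpen U)
    (h : DifferentiableOn ℂ φ U) {u : ℂ → ℝ} (hu : Differentiable ℝ u) {z : ℂ} (hz : z ∈ U) :
    gradient (U.indicator (u ∘ φ)) z = (starRingEnd ℂ) (deriv φ z) * gradient u (φ z) := by
  have hφ := (h.differentiableAt (hU.mem_nhds hz)).hasDerivAt.hasFDerivAt.restrictScalars ℝ
  have hc := (hu (φ z)).hasFDerivAt.comp z hφ
  have hc' : HasFDerivAt (U.indicator (u ∘ φ)) _ z := hc.congr_of_eventuallyEq (by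
    filter_upwards [hU.mem_nhds hz] with w hw using indicator_of_mem hw _)
  refine ext_inner_right ℝ fun e => ?_
  rw [gradient, hc'.fderiv, InnerProductSpace.toDual_symm_apply]
  have h2 : inner ℝ (gradient u (φ z)) (deriv φ z * e) = fderiv ℝ u (φ z) (deriv φ z * e) := by
    rw [gradient, InnerProductSpace.toDual_symm_apply]
  simp only [ContinuousLinearMap.comp_apply, ContinuousLinearMap.coe_restrictScalars',
    ContinuousLinearMap.toSpanSingleton_apply, smul_eq_mul]
  rw [mul_comm e, ← h2]
  simp only [Complex.inner, map_mul, Complex.conj_conj]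
  ring_nf

theorem jacobian_eq {φ : ℂ → ℂ} {z : ℂ} (h : DifferentiableAt ℂ φ z) :
    jacobian φ z = ‖deriv φ z‖ ^ 2 := by
  rw [jacobian, h.hasDerivAt.hasFDerivAt.restrictScalars ℝ |>.fderiv]
  simp [ContinuousLinearMap.det, LinearMap.det_restrictScalars, Algebra.norm_complex_apply,
    Complex.normSq_eq_norm_sq]

end Conformal

/-! ### Sobolev inequality on the disc and the Hilbert space of gradients. -/

noncomputable section

section SobolevSpace

open Filter Topology
open scoped NNReal

theorem norm_gradient_eq (u : ℂ → ℝ) (z : ℂ) : ‖gradient u z‖ = ‖fderiv ℝ u z‖ := by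
  rw [gradient, LinearIsometryEquiv.norm_map]

theorem IsTestFunction.continuous_gradient {Ω : Set ℂ} {u : ℂ → ℝ} (hu : IsTestFunction Ω u) :
    Continuous (gradient u) :=
  (InnerProductSpace.toDual ℝ ℂ).symm.continuous.comp (hu.1.continuous_fderiv (by simp))

theorem IsTestFunction.hasCompactSupport_gradient {Ω : Set ℂ} {u : ℂ → ℝ}
    (hu : IsTestFunction Ω u) : HasCompactSupport (gradient u) :=
  (hu.2.1.fderiv ℝ).comp_left (map_zero (InnerProductSpace.toDual ℝ ℂ).symm)

theorem IsTestFunction.memLp {Ω : Set ℂ} {u : ℂ → ℝ} (hu : IsTestFunction Ω u) (p : ℝ≥0∞) :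
    MemLp u p (volume.restrict Ω) :=
  (hu.1.continuous.memLp_of_hasCompactSupport hu.2.1).restrict Ω

theorem IsTestFunction.memLp_gradient {Ω : Set ℂ} {u : ℂ → ℝ} (hu : IsTestFunction Ω u)
    (p : ℝ≥0∞) : MemLp (gradient u) p (volume.restrict Ω) :=
  (hu.continuous_gradient.memLp_of_hasCompactSupport hu.hasCompactSupport_gradient).restrict Ω

theorem IsTestFunction.add {Ω : Set ℂ} {u v : ℂ → ℝ} (hu : IsTestFunction Ω u)
    (hv : IsTestFunction Ω v) : IsTestFunction Ω (u + v) :=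
  ⟨hu.1.add hv.1, hu.2.1.add hv.2.1, (tsupport_add u v).trans (union_subset hu.2.2 hv.2.2)⟩

theorem IsTestFunction.const_smul {Ω : Set ℂ} {u : ℂ → ℝ} (hu : IsTestFunction Ω u) (c : ℝ) :
    IsTestFunction Ω (c • u) :=
  ⟨hu.1.const_smul c, hu.2.1.smul_left (f := fun _ => c),
    (closure_mono (Function.support_const_smul_subset c u)).trans hu.2.2⟩

theorem IsTestFunction.zero (Ω : Set ℂ) : IsTestFunction Ω 0 :=
  ⟨contDiff_const, HasCompactSupport.zero, by simp [tsupport]⟩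

/-- The pairs `(u, ∇u)` with `u ∈ C_0^∞(Ω)`, as a subspace. -/
def testPairSubmodule (Ω : Set ℂ) : Submodule ℝ (L2Pairs Ω) where
  carrier := testPairs Ω
  add_mem' := by
    rintro a b ⟨u, hu, hu1, hu2⟩ ⟨v, hv, hv1, hv2⟩
    refine ⟨u + v, hu.add hv, ?_, ?_⟩
    · filter_upwards [Lp.coeFn_add a.fst b.fst, hu1, hv1] with z h1 h2 h3
      rw [WithLp.add_fst, h1, Pi.add_apply, Pi.add_apply, h2, h3]
    · filter_upwards [Lp.coeFn_add a.snd b.snd, hu2, hv2] with z h1 h2 h3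
      rw [WithLp.add_snd, h1, Pi.add_apply, h2, h3, gradient, gradient, gradient,
        fderiv_add (hu.1.differentiable (by simp) z) (hv.1.differentiable (by simp) z), map_add]
  zero_mem' := by
    refine ⟨0, IsTestFunction.zero Ω, ?_, ?_⟩
    · exact Lp.coeFn_zero _ _ _
    · filter_upwards [Lp.coeFn_zero ℂ 2 (volume.restrict Ω)] with z h1
      rw [WithLp.zero_snd, h1]
      simp [gradient]
  smul_mem' := by
    rintro c a ⟨u, hu, hu1, hu2⟩
    refine ⟨c • u, hu.const_smul c, ?_, ?_⟩
    · filter_upwards [Lp.coeFn_smul c a.fst, hu1] with z h1 h2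
      rw [WithLp.smul_fst, h1, Pi.smul_apply, Pi.smul_apply, h2]
    · filter_upwards [Lp.coeFn_smul c a.snd, hu2] with z h1 h2
      rw [WithLp.smul_snd, h1, Pi.smul_apply, h2, gradient, gradient,
        fderiv_const_smul (hu.1.differentiable (by simp) z), map_smul]

theorem W012_eq (Ω : Set ℂ) : W012 Ω = (testPairSubmodule Ω).topologicalClosure := by
  rw [W012]
  congr 1
  exact Submodule.span_eq (testPairSubmodule Ω)

theorem coe_W012 (Ω : Set ℂ) : (W012 Ω : Set (L2Pairs Ω)) = closure (testPairs Ω) := by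
  rw [W012_eq, Submodule.topologicalClosure_coe]
  rfl

instance (Ω : Set ℂ) : CompleteSpace (W012 Ω) :=
  (Submodule.isClosed_topologicalClosure _).completeSpace_coe

/-- The element `(u, ∇u)` of the Sobolev space given by a test function. -/
def IsTestFunction.pair {Ω : Set ℂ} {u : ℂ → ℝ} (hu : IsTestFunction Ω u) : L2Pairs Ω :=
  WithLp.toLp 2 ((hu.memLp 2).toLp, (hu.memLp_gradient 2).toLp)

theorem IsTestFunction.pair_mem {Ω : Set ℂ} {u : ℂ → ℝ} (hu : IsTestFunction Ω u) :
    hu.pair ∈ testPairs Ω :=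
  ⟨u, hu, (hu.memLp 2).coeFn_toLp, (hu.memLp_gradient 2).coeFn_toLp⟩

theorem mem_testPairs_iff {Ω : Set ℂ} {w : L2Pairs Ω} :
    w ∈ testPairs Ω ↔ ∃ u, ∃ hu : IsTestFunction Ω u, w = hu.pair := by
  constructor
  · rintro ⟨u, hu, h1, h2⟩
    refine ⟨u, hu, ?_⟩
    have e1 : w.fst = hu.pair.fst := Lp.ext (h1.trans (hu.memLp 2).coeFn_toLp.symm)
    have e2 : w.snd = hu.pair.snd := Lp.ext (h2.trans (hu.memLp_gradient 2).coeFn_toLp.symm)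
    exact WithLp.ofLp_injective 2 (Prod.ext e1 e2)
  · rintro ⟨u, hu, rfl⟩
    exact hu.pair_mem

theorem testPairs_subset_W012 (Ω : Set ℂ) : testPairs Ω ⊆ W012 Ω := by
  rw [coe_W012]
  exact subset_closure

instance : IsFiniteMeasure (volume.restrict unitDisc) :=
  ⟨by rw [Measure.restrict_apply_univ]; exact measure_ball_lt_top⟩

/-- The **Sobolev inequality** for test functions in the unit disc. -/
theorem exists_sobolev_testFunction {q : ℝ≥0} (hq : 2 ≤ q) :
    ∃ C : ℝ≥0, ∀ u, IsTestFunction unitDisc u → eLpNorm u q (volume.restrict unitDisc) ≤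
      C * eLpNorm (gradient u) 2 (volume.restrict unitDisc) := by
  have hq0 : (0 : ℝ≥0) < q := by positivity
  -- `r` is the exponent with `1/r - 1/2 = 1/q`, whose Sobolev conjugate in the plane is `q`. As `r
  -- < 2` and the disc has finite measure, the L^r norm of the gradient is bounded by its L² norm.
  set r : ℝ≥0 := 2 * q / (q + 2) with hr
  have hr1 : 1 ≤ r := by
    rw [hr, le_div_iff₀ (by positivity), one_mul, two_mul]
    gcongr
  have hr2 : r < 2 := by
    rw [hr, div_lt_iff₀ (by positivity), mul_add]
    exact lt_add_of_pos_right _ (by norm_num)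
  have hrq : (r : ℝ)⁻¹ - (Module.finrank ℝ ℂ : ℝ)⁻¹ ≤ (q : ℝ)⁻¹ := by
    rw [Complex.finrank_real_complex, hr]
    have : (0 : ℝ) < q := by exact_mod_cast hq0
    push_cast
    apply le_of_eq
    field_simp
    ring
  refine ⟨eLpNormLESNormFDerivOfLeConst ℝ (volume : Measure ℂ) unitDisc r q *
    (volume.restrict unitDisc univ ^ (1 / (r : ℝ≥0∞).toReal - 1 / (2 : ℝ≥0∞).toReal)).toNNReal,
    fun u hu => ?_⟩
  have hsupp : u.support ⊆ unitDisc := (subset_tsupport u).trans hu.2.2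
  have hsupp' : (gradient u).support ⊆ unitDisc := by
    refine fun z hz => hu.2.2 (support_fderiv_subset ℝ (f := u) ?_)
    rw [Function.mem_support] at hz ⊢
    rw [← norm_ne_zero_iff] at hz ⊢
    rwa [norm_gradient_eq] at hz
  have h1 := eLpNorm_le_eLpNorm_fderiv_of_le (volume : Measure ℂ) (hu.1.of_le (by simp)) hsupp hr1
    (by rw [Complex.finrank_real_complex]; exact_mod_cast hr2) hrq isBounded_ball
  have h2 : eLpNorm (fderiv ℝ u) r volume = eLpNorm (gradient u) r (volume.restrict unitDisc) := by
    rw [eLpNorm_restrict_eq_of_support_subset hsupp']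
    exact eLpNorm_congr_norm_ae (Eventually.of_forall fun z => (norm_gradient_eq u z).symm)
  rw [eLpNorm_restrict_eq_of_support_subset hsupp, ENNReal.coe_mul, mul_assoc]
  refine h1.trans ?_
  rw [h2]
  gcongr
  rw [ENNReal.coe_toNNReal, mul_comm]
  · exact eLpNorm_le_eLpNorm_mul_rpow_measure_univ (by exact_mod_cast hr2.le)
      hu.continuous_gradient.aestronglyMeasurable
  · refine ENNReal.rpow_ne_top_of_nonneg ?_ (measure_ne_top _ _)
    rw [sub_nonneg]
    simp only [ENNReal.coe_toReal, ENNReal.toReal_ofNat]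
    have h3 : (1 : ℝ) ≤ r := by exact_mod_cast hr1
    have h4 : (r : ℝ) ≤ 2 := by exact_mod_cast hr2.le
    exact one_div_le_one_div_of_le (by linarith) h4

theorem enorm_snd_pair {Ω : Set ℂ} {u : ℂ → ℝ} (hu : IsTestFunction Ω u) :
    ‖hu.pair.snd‖ₑ = eLpNorm (gradient u) 2 (volume.restrict Ω) :=
  Lp.enorm_toLp (hu.memLp_gradient 2)

/-- A bound of an `L^q` norm by the gradient passes from test functions to the Sobolev space. -/
theorem eLpNorm_fst_le_of_testFunction {Ω : Set ℂ} {q : ℝ≥0∞} {C : ℝ≥0}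
    (h : ∀ u, IsTestFunction Ω u → eLpNorm u q (volume.restrict Ω) ≤
      C * eLpNorm (gradient u) 2 (volume.restrict Ω)) {w : L2Pairs Ω} (hw : w ∈ W012 Ω) :
    eLpNorm w.fst q (volume.restrict Ω) ≤ C * ‖w.snd‖ₑ := by
  have hw' : w ∈ closure (testPairs Ω) := by rw [← coe_W012]; exact hw
  obtain ⟨x, hx, hlim⟩ := mem_closure_iff_seq_limit.1 hw'
  have hfst : Tendsto (fun n => (x n).fst) atTop (𝓝 w.fst) :=
    ((WithLp.continuous_fst 2 _ _).tendsto w).comp hlim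
  have hsnd : Tendsto (fun n => ‖(x n).snd‖ₑ) atTop (𝓝 ‖w.snd‖ₑ) :=
    (continuous_enorm.tendsto _).comp (((WithLp.continuous_snd 2 _ _).tendsto w).comp hlim)
  -- Convergence in L² yields an a.e. convergent subsequence, to which Fatou's lemma for the L^q
  -- norm applies.
  obtain ⟨s, hs, hae⟩ := (tendstoInMeasure_of_tendsto_Lp hfst).exists_seq_tendsto_ae
  refine (Lp.eLpNorm_lim_le_liminf_eLpNorm (fun n => Lp.aestronglyMeasurable _) _ hae).trans ?_
  have hb : ∀ n, eLpNorm (x (s n)).fst q (volume.restrict Ω) ≤ C * ‖(x (s n)).snd‖ₑ := by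
    intro n
    obtain ⟨u, hu, hxu⟩ := mem_testPairs_iff.1 (hx (s n))
    rw [hxu, enorm_snd_pair, eLpNorm_congr_ae (show hu.pair.fst =ᵐ[_] u from
      (hu.memLp 2).coeFn_toLp)]
    exact h u hu
  refine (liminf_le_liminf (Eventually.of_forall hb)).trans_eq ?_
  exact (ENNReal.Tendsto.const_mul (hsnd.comp hs.tendsto_atTop)
    (Or.inr ENNReal.coe_ne_top)).liminf_eq

theorem exists_sobolev {q : ℝ≥0} (hq : 2 ≤ q) :
    ∃ C : ℝ≥0, ∀ w ∈ W012 unitDisc, eLpNorm w.fst q (volume.restrict unitDisc) ≤ C * ‖w.snd‖ₑ := by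
  obtain ⟨C, hC⟩ := exists_sobolev_testFunction hq
  exact ⟨C, fun w hw => eLpNorm_fst_le_of_testFunction hC hw⟩

/-- The best constant is itself admissible: the set of admissible constants is closed, nonempty and
bounded below. -/
theorem eLpNorm_le_sobolevConst {q : ℝ≥0∞} (hq : 2 ≤ q) (hq' : q ≠ ⊤) (f : W012 unitDisc) :
    eLpNorm f.1.fst q (volume.restrict unitDisc) ≤ ENNReal.ofReal (sobolevConst q * ‖f.1.snd‖) := by
  lift q to ℝ≥0 using hq'
  obtain ⟨C, hC⟩ := exists_sobolev (by exact_mod_cast hq : 2 ≤ q)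
  set A := {C : ℝ | 0 ≤ C ∧ ∀ f : W012 unitDisc,
    eLpNorm f.1.fst q (volume.restrict unitDisc) ≤ ENNReal.ofReal (C * ‖f.1.snd‖)} with hA
  have hne : A.Nonempty := by
    refine ⟨C, C.2, fun f => (hC _ f.2).trans_eq ?_⟩
    rw [ENNReal.ofReal_mul (NNReal.coe_nonneg C), ofReal_norm, ENNReal.ofReal_coe_nnreal]
  have hbdd : BddBelow A := ⟨0, fun _ h => h.1⟩
  have hcl : IsClosed A := by
    rw [hA, ofPred_and, ofPred_forall]
    refine isClosed_Ici.inter (isClosed_iInter fun f => ?_)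
    exact isClosed_le continuous_const (ENNReal.continuous_ofReal.comp (by fun_prop))
  exact (hcl.csInf_mem hne hbdd).2 f

theorem sobolevConst_nonneg (q : ℝ≥0∞) : 0 ≤ sobolevConst q := Real.sInf_nonneg fun _ h => h.1

/-- The gradient on `W_0^{1,2}` of the unit disc. -/
def discGradient : W012 unitDisc →L[ℝ] Lp ℂ 2 (volume.restrict unitDisc) :=
  (WithLp.sndL 2 ℝ _ _) ∘L (W012 unitDisc).subtypeL

/-- The Sobolev inequality with `q = 2` is Poincaré's, so the gradient norm controls the full norm.
Hence the gradient is injective with closed range, and `DiscGradients` is a Hilbert space. -/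
theorem exists_antilipschitz_discGradient : ∃ K, AntilipschitzWith K discGradient := by
  obtain ⟨C, hC⟩ := exists_sobolev le_rfl
  refine ⟨C + 1, AddMonoidHomClass.antilipschitz_of_bound _ fun w => ?_⟩
  have h1 : ‖w.1.fst‖ ≤ C * ‖w.1.snd‖ := by
    have h := hC _ w.2
    rw [show ((2 : ℝ≥0) : ℝ≥0∞) = 2 from rfl, ← Lp.enorm_def] at h
    have h' : ‖w.1.fst‖₊ ≤ C * ‖w.1.snd‖₊ := by
      simp only [enorm_eq_nnnorm] at h
      exact_mod_cast h
    exact_mod_cast h'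
  have h2 : ‖w.1‖ ^ 2 = ‖w.1.fst‖ ^ 2 + ‖w.1.snd‖ ^ 2 := WithLp.prod_norm_sq_eq_of_L2 _
  have h3 : ‖w‖ ^ 2 ≤ ((C + 1 : ℝ) * ‖w.1.snd‖) ^ 2 := by
    change ‖w.1‖ ^ 2 ≤ _
    rw [h2]
    have h4 : ‖w.1.fst‖ ^ 2 ≤ (C * ‖w.1.snd‖) ^ 2 := by gcongr
    have := C.2
    nlinarith [mul_nonneg this (sq_nonneg ‖w.1.snd‖)]
  exact le_of_sq_le_sq h3 (by positivity)

theorem discGradient_injective : Function.Injective discGradient :=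
  exists_antilipschitz_discGradient.choose_spec.injective

theorem isClosed_range_discGradient : IsClosed (range discGradient) :=
  exists_antilipschitz_discGradient.choose_spec.isClosed_range discGradient.uniformContinuous

/-- The gradients of the functions in `W_0^{1,2}` of the unit disc. -/
abbrev DiscGradients : Submodule ℝ (Lp ℂ 2 (volume.restrict unitDisc)) := discGradient.range

instance : CompleteSpace DiscGradients := isClosed_range_discGradient.completeSpace_coe

/-- The function in `W_0^{1,2}` of the unit disc with a given gradient. -/
def discPrimitive : DiscGradients ≃L[ℝ] W012 unitDisc :=
  (discGradient.equivRange discGradient_injective isClosed_range_discGradient).symm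

theorem discPrimitive_snd (g : DiscGradients) : (discPrimitive g).1.snd = g :=
  congrArg Subtype.val
    ((discGradient.equivRange discGradient_injective
      isClosed_range_discGradient).apply_symm_apply g)

theorem discPrimitive_symm (w : W012 unitDisc) :
    ((discPrimitive.symm w : DiscGradients) : Lp ℂ 2 (volume.restrict unitDisc)) = w.1.snd := by
  rw [← discPrimitive_snd, ContinuousLinearEquiv.apply_symm_apply]

end SobolevSpace

end

/-! ### Rellich's theorem on the disc by piecewise constant approximation. -/

noncomputable section

section Rellich

open Filter Topology
open scoped NNReal

theorem eLpNorm_two_sq {α E : Type*} [MeasurableSpace α] {μ : Measure α} [NormedAddCommGroup E]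
    (f : α → E) : eLpNorm f 2 μ ^ 2 = ∫⁻ x, ‖f x‖ₑ ^ 2 ∂μ := by
  have h := eLpNorm_nnreal_pow_eq_lintegral (f := f) (μ := μ) (p := 2) (by norm_num)
  simpa using h

/-- The fundamental theorem of calculus on the segment from `x` to `x + h`, then the inequality
between L¹ and L² norms on a probability space. -/
theorem enorm_sub_sq_le_lintegral {u : ℂ → ℝ} (hu : ContDiff ℝ 1 u) (x h : ℂ) :
    ‖u (x + h) - u x‖ₑ ^ 2 ≤
      ∫⁻ t in Ioc (0 : ℝ) 1, (‖h‖ₑ ^ 2 * ‖fderiv ℝ u (x + t • h)‖ₑ ^ 2) := by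
  have hc : Continuous fun t : ℝ => fderiv ℝ u (x + t • h) h :=
    ((hu.continuous_fderiv one_ne_zero).comp (by fun_prop)).clm_apply continuous_const
  have hd : ∀ t : ℝ, HasDerivAt (fun t : ℝ => u (x + t • h)) (fderiv ℝ u (x + t • h) h) t := by
    intro t
    have h1 : HasDerivAt (fun t : ℝ => x + t • h) h t := by
      simpa using ((hasDerivAt_id t).smul_const h).const_add x
    exact (hu.differentiable (by simp) _).hasFDerivAt.comp_hasDerivAt t h1
  have hint := intervalIntegral.integral_eq_sub_of_hasDerivAt (a := 0) (b := 1)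
    (fun t _ => hd t) (hc.intervalIntegrable 0 1)
  simp only [one_smul, zero_smul, add_zero] at hint
  rw [← hint, intervalIntegral.integral_of_le zero_le_one]
  have : IsProbabilityMeasure (volume.restrict (Ioc (0 : ℝ) 1)) := ⟨by simp⟩
  calc ‖∫ t in Ioc (0 : ℝ) 1, fderiv ℝ u (x + t • h) h‖ₑ ^ 2
      ≤ eLpNorm (fun t : ℝ => fderiv ℝ u (x + t • h) h) 1 (volume.restrict (Ioc (0 : ℝ) 1)) ^ 2 := by
        rw [eLpNorm_one_eq_lintegral_enorm]
        gcongr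
        exact enorm_integral_le_lintegral_enorm _
    _ ≤ eLpNorm (fun t : ℝ => fderiv ℝ u (x + t • h) h) 2 (volume.restrict (Ioc (0 : ℝ) 1)) ^ 2 := by
        gcongr
        exact eLpNorm_le_eLpNorm_of_exponent_le (by norm_num) hc.aestronglyMeasurable
    _ = ∫⁻ t in Ioc (0 : ℝ) 1, ‖fderiv ℝ u (x + t • h) h‖ₑ ^ 2 := eLpNorm_two_sq _
    _ ≤ _ := by
        refine lintegral_mono fun t => ?_
        rw [← mul_pow, mul_comm]
        gcongr
        exact ContinuousLinearMap.le_opENorm _ _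

/-- The `L²` modulus of continuity under translation is controlled by the gradient. -/
theorem lintegral_translate_sub_sq_le {u : ℂ → ℝ} (hu : ContDiff ℝ 1 u) (h : ℂ) :
    ∫⁻ x, ‖u (x + h) - u x‖ₑ ^ 2 ≤ ‖h‖ₑ ^ 2 * ∫⁻ x, ‖fderiv ℝ u x‖ₑ ^ 2 := by
  have hc := hu.continuous_fderiv one_ne_zero
  calc ∫⁻ x, ‖u (x + h) - u x‖ₑ ^ 2
      ≤ ∫⁻ x, ∫⁻ t in Ioc (0 : ℝ) 1, (‖h‖ₑ ^ 2 * ‖fderiv ℝ u (x + t • h)‖ₑ ^ 2) :=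
        lintegral_mono fun x => enorm_sub_sq_le_lintegral hu x h
    _ = ∫⁻ t in Ioc (0 : ℝ) 1, ∫⁻ x, (‖h‖ₑ ^ 2 * ‖fderiv ℝ u (x + t • h)‖ₑ ^ 2) := by
        refine lintegral_lintegral_swap (Measurable.aemeasurable ?_)
        refine (Continuous.measurable ?_)
        have : Continuous fun p : ℂ × ℝ => ‖fderiv ℝ u (p.1 + p.2 • h)‖ₑ ^ 2 := by
          have : Continuous fun p : ℂ × ℝ => fderiv ℝ u (p.1 + p.2 • h) := hc.comp (by fun_prop)
          exact (ENNReal.continuous_pow 2).comp this.enorm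
        exact (ENNReal.continuous_const_mul (by finiteness)).comp this
    _ = ∫⁻ t in Ioc (0 : ℝ) 1, ‖h‖ₑ ^ 2 * ∫⁻ x, ‖fderiv ℝ u x‖ₑ ^ 2 := by
        refine lintegral_congr fun t => ?_
        rw [lintegral_const_mul' _ _ (by finiteness),
          lintegral_add_right_eq_self (fun x => ‖fderiv ℝ u x‖ₑ ^ 2)]
    _ = _ := by simp

/-- Averaging over shifts `s` in the ball of radius `ε`: the displacement `c x + s - x` stays in the
ball of radius `3ε`, where the translation bound is `(3ε)²` times the Dirichlet integral. The area
ratio 9 makes this `81 ε²`, and some `s` does no worse than the average. The shift avoids point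
values of `u`, which the gradient does not control in the plane. -/
theorem exists_sample_sq_le {u : ℂ → ℝ} (hu : ContDiff ℝ 1 u) {A : Set ℂ} (hA : MeasurableSet A)
    {c : ℂ → ℂ} (hc : Measurable c) {ε : ℝ} (hε : 0 < ε) (hcA : ∀ x ∈ A, dist (c x) x ≤ 2 * ε) :
    ∃ s, ∫⁻ x in A, ‖u (c x + s) - u x‖ₑ ^ 2 ≤
      ENNReal.ofReal (81 * ε ^ 2) * ∫⁻ x, ‖fderiv ℝ u x‖ₑ ^ 2 := by
  set I := ∫⁻ x, ‖fderiv ℝ u x‖ₑ ^ 2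
  have hum := hu.continuous.measurable
  have hF : Measurable fun p : ℂ × ℂ => ‖u (c p.2 + p.1) - u p.2‖ₑ ^ 2 := by fun_prop
  have hmeas : Measurable fun s => ∫⁻ x in A, ‖u (c x + s) - u x‖ₑ ^ 2 :=
    hF.lintegral_prod_right'
  obtain ⟨s, -, hs⟩ := exists_le_setLAverage (μ := (volume : Measure ℂ)) (s := ball (0 : ℂ) ε)
    (measure_ball_pos _ _ hε).ne' measure_ball_lt_top.ne hmeas.aemeasurable
  refine ⟨s, hs.trans ?_⟩
  have hball : volume (ball (0 : ℂ) (3 * ε)) = 9 * volume (ball (0 : ℂ) ε) := by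
    rw [Complex.volume_ball, Complex.volume_ball, ENNReal.ofReal_mul (by norm_num), mul_pow,
      mul_assoc]
    norm_num
  have key : ∫⁻ s in ball (0 : ℂ) ε, ∫⁻ x in A, ‖u (c x + s) - u x‖ₑ ^ 2 ≤
      9 * volume (ball (0 : ℂ) ε) * (ENNReal.ofReal (9 * ε ^ 2) * I) := by
    calc ∫⁻ s in ball (0 : ℂ) ε, ∫⁻ x in A, ‖u (c x + s) - u x‖ₑ ^ 2
        = ∫⁻ x in A, ∫⁻ s in ball (0 : ℂ) ε, ‖u (c x + s) - u x‖ₑ ^ 2 :=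
          lintegral_lintegral_swap hF.aemeasurable
      _ ≤ ∫⁻ x in A, ∫⁻ h in ball (0 : ℂ) (3 * ε), ‖u (x + h) - u x‖ₑ ^ 2 := by
          refine setLIntegral_mono' hA fun x hx => ?_
          rw [← lintegral_indicator measurableSet_ball, ← lintegral_indicator measurableSet_ball,
            ← lintegral_add_left_eq_self
              ((ball (0 : ℂ) (3 * ε)).indicator fun h => ‖u (x + h) - u x‖ₑ ^ 2) (c x - x)]
          refine lintegral_mono fun s => ?_
          by_cases hs : s ∈ ball (0 : ℂ) ε
          · have hs' : c x - x + s ∈ ball (0 : ℂ) (3 * ε) := by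
              rw [mem_ball_zero_iff] at hs ⊢
              have := hcA x hx
              rw [dist_eq_norm] at this
              linarith [norm_add_le (c x - x) s]
            rw [indicator_of_mem hs, indicator_of_mem hs',
              show x + (c x - x + s) = c x + s by ring]
          · rw [indicator_of_notMem hs]
            exact zero_le
      _ ≤ ∫⁻ x, ∫⁻ h in ball (0 : ℂ) (3 * ε), ‖u (x + h) - u x‖ₑ ^ 2 :=
          setLIntegral_le_lintegral _ _
      _ = ∫⁻ h in ball (0 : ℂ) (3 * ε), ∫⁻ x, ‖u (x + h) - u x‖ₑ ^ 2 := by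
          refine lintegral_lintegral_swap (Measurable.aemeasurable ?_)
          fun_prop
      _ ≤ ∫⁻ h in ball (0 : ℂ) (3 * ε), ENNReal.ofReal (9 * ε ^ 2) * I := by
          refine setLIntegral_mono' measurableSet_ball fun h hh => ?_
          refine (lintegral_translate_sub_sq_le hu h).trans ?_
          gcongr
          rw [mem_ball_zero_iff] at hh
          rw [← ofReal_norm, ← ENNReal.ofReal_pow (norm_nonneg _)]
          refine ENNReal.ofReal_le_ofReal ?_
          nlinarith [norm_nonneg h]
      _ = 9 * volume (ball (0 : ℂ) ε) * (ENNReal.ofReal (9 * ε ^ 2) * I) := by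
          rw [setLIntegral_const, hball, mul_comm]
  rw [setLAverage_eq]
  refine ENNReal.div_le_of_le_mul (key.trans_eq ?_)
  rw [show (81 : ℝ) * ε ^ 2 = 9 * (9 * ε ^ 2) by ring, ENNReal.ofReal_mul (p := 9) (by norm_num)]
  norm_num
  ring

/-- The square of the grid of mesh `1/N` that contains a point of the unit disc. -/
def gridCell (N : ℕ) (z : ℂ) : Icc (-N : ℤ) N × Icc (-N : ℤ) N :=
  (projIcc (-N : ℤ) N (by omega) ⌊N * z.re⌋, projIcc (-N : ℤ) N (by omega) ⌊N * z.im⌋)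

/-- The lower left corner of a square of the grid. -/
def gridCorner (N : ℕ) (i : Icc (-N : ℤ) N × Icc (-N : ℤ) N) : ℂ :=
  ⟨(i.1 : ℤ) / N, (i.2 : ℤ) / N⟩

theorem measurable_gridCell (N : ℕ) : Measurable (gridCell N) := by
  refine Measurable.prodMk ?_ ?_
  · exact (measurable_from_top (f := projIcc (-N : ℤ) N (by omega))).comp
      (Int.measurable_floor.comp (Complex.measurable_re.const_mul _))
  · exact (measurable_from_top (f := projIcc (-N : ℤ) N (by omega))).comp
      (Int.measurable_floor.comp (Complex.measurable_im.const_mul _))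

theorem abs_floor_div_sub_le {N : ℕ} (hN : 0 < N) {t : ℝ} (ht : |t| ≤ 1) :
    |((projIcc (-N : ℤ) N (by omega) ⌊N * t⌋ : ℤ) : ℝ) / N - t| ≤ 1 / N := by
  have hN' : (0 : ℝ) < N := by exact_mod_cast hN
  have hmem : ⌊N * t⌋ ∈ Icc (-N : ℤ) N := by
    rw [abs_le] at ht
    constructor
    · rw [Int.le_floor]
      push_cast
      nlinarith
    · have h1 := Int.floor_le ((N : ℝ) * t)
      have h2 : (⌊N * t⌋ : ℝ) ≤ (N : ℤ) := by push_cast; nlinarith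
      exact_mod_cast h2
  rw [projIcc_of_mem _ hmem]
  have h1 := Int.floor_le ((N : ℝ) * t)
  have h2 := Int.lt_floor_add_one ((N : ℝ) * t)
  rw [div_sub' hN'.ne', abs_div, abs_of_pos hN']
  gcongr
  rw [abs_le]
  constructor <;> simp only <;> linarith

theorem dist_gridCorner_le {N : ℕ} (hN : 0 < N) {z : ℂ} (hz : z ∈ unitDisc) :
    dist (gridCorner N (gridCell N z)) z ≤ 2 * (1 / N) := by
  have hz' : ‖z‖ ≤ 1 := (mem_ball_zero_iff.1 hz).le
  rw [dist_eq_norm, two_mul]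
  refine (Complex.norm_le_abs_re_add_abs_im _).trans (add_le_add ?_ ?_)
  · exact abs_floor_div_sub_le hN ((Complex.abs_re_le_norm z).trans hz')
  · exact abs_floor_div_sub_le hN ((Complex.abs_im_le_norm z).trans hz')

theorem memLp_comp_gridCell (N : ℕ) (a : Icc (-N : ℤ) N × Icc (-N : ℤ) N → ℝ) :
    MemLp (fun z => a (gridCell N z)) 2 (volume.restrict unitDisc) :=
  MemLp.of_bound (((measurable_of_finite a).comp (measurable_gridCell N)).aestronglyMeasurable)
    ‖a‖ (Eventually.of_forall fun _ => norm_le_pi_norm a _)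

/-- The functions on the unit disc that are constant on each square of the grid. -/
def gridFunction (N : ℕ) :
    (Icc (-N : ℤ) N × Icc (-N : ℤ) N → ℝ) →ₗ[ℝ] Lp ℝ 2 (volume.restrict unitDisc) where
  toFun a := (memLp_comp_gridCell N a).toLp
  map_add' _ _ := rfl
  map_smul' _ _ := rfl

/-- The samples are taken at the shifted corners of the squares. With `ε = 1/N` the squared error
constant is `81/N²`, whence `9/N`. -/
theorem exists_gridFunction_sub_le {N : ℕ} (hN : 0 < N) {u : ℂ → ℝ}
    (hu : IsTestFunction unitDisc u) :
    ∃ a, ‖hu.pair.fst - gridFunction N a‖ ≤ 9 / N * ‖hu.pair.snd‖ := by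
  have hN' : (0 : ℝ) < N := by exact_mod_cast hN
  obtain ⟨s, hs⟩ := exists_sample_sq_le (hu.1.of_le (by simp)) (measurableSet_ball (x := (0 : ℂ)))
    ((measurable_of_finite (gridCorner N)).comp (measurable_gridCell N))
    (one_div_pos.2 hN') (fun z hz => dist_gridCorner_le hN hz)
  refine ⟨fun i => u (gridCorner N i + s), ?_⟩
  have h1 : ‖hu.pair.fst - gridFunction N fun i => u (gridCorner N i + s)‖ₑ ^ 2 ≤
      (ENNReal.ofReal (9 / N) * ‖hu.pair.snd‖ₑ) ^ 2 := by
    have e1 : ‖hu.pair.fst - gridFunction N fun i => u (gridCorner N i + s)‖ₑ =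
        eLpNorm (fun z => u (gridCorner N (gridCell N z) + s) - u z) 2
          (volume.restrict unitDisc) := by
      rw [← enorm_neg, neg_sub, Lp.enorm_def]
      refine eLpNorm_congr_ae ?_
      have h3 : gridFunction N (fun i => u (gridCorner N i + s)) =ᵐ[volume.restrict unitDisc]
          fun z => u (gridCorner N (gridCell N z) + s) :=
        (memLp_comp_gridCell N fun i => u (gridCorner N i + s)).coeFn_toLp
      have h4 : hu.pair.fst =ᵐ[volume.restrict unitDisc] u := (hu.memLp 2).coeFn_toLp
      filter_upwards [Lp.coeFn_sub (gridFunction N fun i => u (gridCorner N i + s)) hu.pair.fst,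
        h3, h4] with z h5 h6 h7
      rw [h5, Pi.sub_apply, h6, h7]
    have e2 : ∫⁻ x, ‖fderiv ℝ u x‖ₑ ^ 2 = ‖hu.pair.snd‖ₑ ^ 2 := by
      rw [enorm_snd_pair, eLpNorm_two_sq,
        ← lintegral_indicator (show MeasurableSet unitDisc from measurableSet_ball)]
      refine lintegral_congr fun z => ?_
      have e3 : ‖fderiv ℝ u z‖ₑ = ‖gradient u z‖ₑ := by
        rw [← ofReal_norm, ← ofReal_norm, norm_gradient_eq]
      rw [e3]
      by_cases hz : z ∈ unitDisc
      · rw [indicator_of_mem hz]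
      · have : fderiv ℝ u z = 0 := by
          by_contra h
          exact hz (hu.2.2 (support_fderiv_subset ℝ h))
        rw [indicator_of_notMem hz, gradient, this]
        simp
    rw [e1, eLpNorm_two_sq, mul_pow, ← e2, ← ENNReal.ofReal_pow (by positivity)]
    refine hs.trans_eq ?_
    congr 2
    ring
  have h2 := (ENNReal.pow_le_pow_left_iff two_ne_zero).1 h1
  rw [← ofReal_norm, ← ofReal_norm, ← ENNReal.ofReal_mul (by positivity)] at h2
  exact (ENNReal.ofReal_le_ofReal_iff (by positivity)).1 h2

/-- The embedding of `W_0^{1,2}` of the unit disc, normed by the gradient, into `L²`. -/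
def discEmbedding : DiscGradients →L[ℝ] Lp ℝ 2 (volume.restrict unitDisc) :=
  (WithLp.fstL 2 ℝ _ _) ∘L (W012 unitDisc).subtypeL ∘L (discPrimitive : _ →L[ℝ] _)

/-- An operator that is approximated in norm by its projections to finite-dimensional subspaces is
compact. -/
theorem isCompactOperator_of_starProjection {V W : Type*} [NormedAddCommGroup V] [NormedSpace ℝ V]
    [NormedAddCommGroup W] [InnerProductSpace ℝ W] [CompleteSpace W] {S : V →L[ℝ] W}
    (P : ℕ → Submodule ℝ W) [∀ N, FiniteDimensional ℝ (P N)] {r : ℕ → ℝ}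
    (hr : Tendsto r atTop (𝓝 0))
    (h : ∀ᶠ N in atTop, ∀ x, ‖(P N).starProjection (S x) - S x‖ ≤ r N * ‖x‖) :
    IsCompactOperator S := by
  have hF : ∀ N, IsCompactOperator ((P N).starProjection ∘L S) := by
    intro N
    have h1 : IsCompactOperator (P N).orthogonalProjectionOnto :=
      isCompactOperator_of_locallyCompactSpace_dom _
    exact (h1.comp_clm S).clm_comp (P N).subtypeL
  refine isCompactOperator_of_tendsto (F := fun N => (P N).starProjection ∘L S) (l := atTop) ?_
    (Eventually.of_forall hF)
  rw [tendsto_iff_norm_sub_tendsto_zero]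
  have hr' : Tendsto (fun N => |r N|) atTop (𝓝 0) := by simpa using hr.abs
  refine squeeze_zero' (Eventually.of_forall fun N => norm_nonneg _) (h.mono fun N hN => ?_) hr'
  refine ContinuousLinearMap.opNorm_le_bound _ (abs_nonneg _) fun x => (hN x).trans ?_
  gcongr
  exact le_abs_self _

/-- The **Rellich theorem** for `W_0^{1,2}` of the unit disc. -/
theorem isCompactOperator_discEmbedding : IsCompactOperator discEmbedding := by
  let P : ℕ → Submodule ℝ (Lp ℝ 2 (volume.restrict unitDisc)) := fun N =>
    LinearMap.range (gridFunction N)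
  have hP : ∀ N, FiniteDimensional ℝ (P N) := fun N => inferInstance
  refine isCompactOperator_of_starProjection P (tendsto_const_div_atTop_nhds_zero_nat 9)
    ((eventually_gt_atTop 0).mono fun N hN g => ?_)
  -- The projection is the nearest point of `P N`, so the grid estimate applies to test functions;
  -- the inequality is a closed condition and passes to the closure.
  have hcl : ∀ w ∈ W012 unitDisc,
      ‖(P N).starProjection w.fst - w.fst‖ ≤ 9 / N * ‖w.snd‖ := by
    intro w hw
    have hw' : w ∈ closure (testPairs unitDisc) := by rw [← coe_W012]; exact hw
    refine closure_minimal (t := {w : L2Pairs unitDisc |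
      ‖(P N).starProjection w.fst - w.fst‖ ≤ 9 / N * ‖w.snd‖}) ?_ (isClosed_le ?_ ?_) hw'
    · intro w hw
      obtain ⟨u, hu, rfl⟩ := mem_testPairs_iff.1 hw
      obtain ⟨a, ha⟩ := exists_gridFunction_sub_le hN hu
      refine le_trans ?_ ha
      rw [norm_sub_rev, (P N).starProjection_minimal]
      exact ciInf_le ⟨0, by rintro _ ⟨x, rfl⟩; positivity⟩
        (⟨gridFunction N a, LinearMap.mem_range_self _ a⟩ : P N)
    · have := WithLp.continuous_fst 2 (Lp ℝ 2 (volume.restrict unitDisc))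
        (Lp ℂ 2 (volume.restrict unitDisc))
      fun_prop
    · have := WithLp.continuous_snd 2 (Lp ℝ 2 (volume.restrict unitDisc))
        (Lp ℂ 2 (volume.restrict unitDisc))
      fun_prop
  have h := hcl _ (discPrimitive g).2
  rw [discPrimitive_snd] at h
  exact h

end Rellich

end

/-! ### Weighted embeddings and their Gram operators. -/

noncomputable section

section WeightedEmbedding

open Filter Topology
open scoped NNReal

section Gram

variable {V W : Type*} [NormedAddCommGroup V] [InnerProductSpace ℝ V] [CompleteSpace V]
  [NormedAddCommGroup W] [InnerProductSpace ℝ W] [CompleteSpace W]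

/-- The operator `J† J`. -/
def gramOperator (J : V →L[ℝ] W) : V →L[ℝ] V := ContinuousLinearMap.adjoint J ∘L J

theorem inner_gramOperator_left (J : V →L[ℝ] W) (x y : V) :
    inner ℝ (gramOperator J x) y = inner ℝ (J x) (J y) :=
  ContinuousLinearMap.adjoint_inner_left J y (J x)

theorem isSymmetric_gramOperator (J : V →L[ℝ] W) : (gramOperator J).IsSymmetric := fun x y => by
  simp only [ContinuousLinearMap.coe_coe]
  rw [inner_gramOperator_left, ← real_inner_comm x, inner_gramOperator_left, real_inner_comm]

theorem isCompactOperator_gramOperator {J : V →L[ℝ] W} (hJ : IsCompactOperator J) :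
    IsCompactOperator (gramOperator J) :=
  hJ.clm_comp (ContinuousLinearMap.adjoint J)

theorem inner_gramOperator_pos {J : V →L[ℝ] W} (hJ : Function.Injective J) {x : V} (hx : x ≠ 0) :
    0 < inner ℝ (gramOperator J x) x := by
  rw [inner_gramOperator_left, real_inner_self_eq_norm_sq]
  have : J x ≠ 0 := fun h => hx (hJ (h.trans (map_zero J).symm))
  positivity

/-- Since `e` is onto, the weak equation says that `e u` and `μ J† J (e u)` have the same inner
product with every vector. -/
theorem dirichletLevels_eq_spectralLevels {Ω : Set ℂ} (e : W012 Ω ≃ₗ[ℝ] V) (J : V →L[ℝ] W)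
    (hgrad : ∀ u v : W012 Ω, inner ℝ u.1.snd v.1.snd = inner ℝ (e u) (e v))
    (hfun : ∀ u v : W012 Ω, inner ℝ u.1.fst v.1.fst = inner ℝ (J (e u)) (J (e v))) (n : ℕ) :
    dirichletLevels Ω n = spectralLevels (gramOperator J) n := by
  have key : ∀ (u : W012 Ω) (μ : ℝ), (∀ v : W012 Ω, inner ℝ u.1.snd v.1.snd =
      μ * inner ℝ u.1.fst v.1.fst) ↔ e u = μ • gramOperator J (e u) := by
    intro u μ
    constructor
    · intro h
      refine ext_inner_right ℝ fun y => ?_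
      have := h (e.symm y)
      rw [hgrad, hfun, e.apply_symm_apply] at this
      rw [this, real_inner_smul_left, inner_gramOperator_left]
    · intro h v
      rw [hgrad, hfun, ← inner_gramOperator_left, ← real_inner_smul_left, ← h]
  ext t
  constructor
  · rintro ⟨u, hu, h⟩
    refine ⟨fun i => e (u i), hu.map' (e : W012 Ω →ₗ[ℝ] V) e.ker, fun i => ?_⟩
    obtain ⟨μ, hμ, hi⟩ := h i
    exact ⟨μ, hμ, (key _ _).1 hi.2⟩
  · rintro ⟨x, hx, h⟩
    have hli : LinearIndependent ℝ fun i => e.symm (x i) :=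
      hx.map' (e.symm : V →ₗ[ℝ] W012 Ω) e.symm.ker
    refine ⟨fun i => e.symm (x i), hli, fun i => ?_⟩
    obtain ⟨μ, hμ, hi⟩ := h i
    refine ⟨μ, hμ, hli.ne_zero i, (key _ _).2 ?_⟩
    rwa [e.apply_symm_apply]

end Gram

theorem isCompactOperator_of_dense {X V W : Type*} [NormedAddCommGroup X] [NormedSpace ℝ X]
    [NormedAddCommGroup V] [NormedSpace ℝ V] [NormedAddCommGroup W] [NormedSpace ℝ W]
    [CompleteSpace W] (Φ : X →L[ℝ] V →L[ℝ] W) {D : Set X} (hD : Dense D)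
    (h : ∀ x ∈ D, IsCompactOperator (Φ x)) (x : X) : IsCompactOperator (Φ x) :=
  closure_minimal (t := Φ ⁻¹' {f | IsCompactOperator f}) h
    (isClosed_setOfPred_isCompactOperator.preimage Φ.continuous) (hD x)

/-- Composition of a bilinear map with a linear map in the second variable. -/
def bilinComp {X V L W : Type*} [NormedAddCommGroup X] [NormedSpace ℝ X]
    [NormedAddCommGroup V] [NormedSpace ℝ V] [NormedAddCommGroup L] [NormedSpace ℝ L]
    [NormedAddCommGroup W] [NormedSpace ℝ W] (B : X →L[ℝ] L →L[ℝ] W) (S : V →L[ℝ] L) :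
    X →L[ℝ] V →L[ℝ] W :=
  ((ContinuousLinearMap.compL ℝ V L W).flip S) ∘L B

theorem discEmbedding_eq (g : DiscGradients) : discEmbedding g = (discPrimitive g).1.fst := rfl

theorem discPrimitive_pair {u : ℂ → ℝ} (hu : IsTestFunction unitDisc u)
    (hg : hu.pair.snd ∈ DiscGradients) :
    (discPrimitive ⟨hu.pair.snd, hg⟩).1 = hu.pair := by
  have h : discPrimitive.symm ⟨hu.pair, testPairs_subset_W012 _ hu.pair_mem⟩ =
      ⟨hu.pair.snd, hg⟩ := Subtype.ext (discPrimitive_symm _)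
  rw [← h, ContinuousLinearEquiv.apply_symm_apply]

variable {p s : ℝ≥0∞}

theorem memLp_discEmbedding (hs : 2 ≤ s) (hs' : s ≠ ⊤) (g : DiscGradients) :
    MemLp (discEmbedding g) s (volume.restrict unitDisc) :=
  ⟨Lp.aestronglyMeasurable _,
    (eLpNorm_le_sobolevConst hs hs' (discPrimitive g)).trans_lt ENNReal.ofReal_lt_top⟩

theorem eLpNorm_discEmbedding_le (hs : 2 ≤ s) (hs' : s ≠ ⊤) (g : DiscGradients) :
    eLpNorm (discEmbedding g) s (volume.restrict unitDisc) ≤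
      ENNReal.ofReal (sobolevConst s * ‖g‖) := by
  have h := eLpNorm_le_sobolevConst hs hs' (discPrimitive g)
  rwa [discPrimitive_snd] at h

/-- The Sobolev embedding into `L^s` of the unit disc. -/
def sobolevEmbedding [Fact (1 ≤ s)] (hs : 2 ≤ s) (hs' : s ≠ ⊤) :
    DiscGradients →L[ℝ] Lp ℝ s (volume.restrict unitDisc) :=
  LinearMap.mkContinuous
    { toFun := fun g => (memLp_discEmbedding hs hs' g).toLp
      map_add' := fun x y => by
        rw [← MemLp.toLp_add]
        refine MemLp.toLp_congr _ _ ?_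
        rw [map_add]
        exact Lp.coeFn_add _ _
      map_smul' := fun c x => by
        rw [RingHom.id_apply, ← MemLp.toLp_const_smul]
        refine MemLp.toLp_congr _ _ ?_
        rw [map_smul]
        exact Lp.coeFn_smul _ _ }
    (sobolevConst s) fun g => by
      change ‖(memLp_discEmbedding hs hs' g).toLp‖ ≤ _
      rw [Lp.norm_toLp]
      exact ENNReal.toReal_le_of_le_ofReal
        (mul_nonneg (sobolevConst_nonneg s) (norm_nonneg g)) (eLpNorm_discEmbedding_le hs hs' g)

theorem coeFn_sobolevEmbedding [Fact (1 ≤ s)] (hs : 2 ≤ s) (hs' : s ≠ ⊤) (g : DiscGradients) :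
    sobolevEmbedding hs hs' g =ᵐ[volume.restrict unitDisc] discEmbedding g :=
  (memLp_discEmbedding hs hs' g).coeFn_toLp

variable [Fact (1 ≤ p)] [Fact (1 ≤ s)] [ENNReal.HolderTriple p s 2]

/-- The map `g ↦ w u`, where `u ∈ W_0^{1,2}` of the unit disc has gradient `g`, for a weight
`w ∈ L^p`. -/
def weightedEmbedding (hs : 2 ≤ s) (hs' : s ≠ ⊤) :
    Lp ℝ p (volume.restrict unitDisc) →L[ℝ]
      DiscGradients →L[ℝ] Lp ℝ 2 (volume.restrict unitDisc) :=
  bilinComp ((ContinuousLinearMap.mul ℝ ℝ).holderL (volume.restrict unitDisc) p s 2)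
    (sobolevEmbedding hs hs')

theorem coeFn_weightedEmbedding (hs : 2 ≤ s) (hs' : s ≠ ⊤)
    (w : Lp ℝ p (volume.restrict unitDisc)) (g : DiscGradients) :
    weightedEmbedding hs hs' w g =ᵐ[volume.restrict unitDisc] fun z => w z * discEmbedding g z := by
  have h : weightedEmbedding hs hs' w g =
    (ContinuousLinearMap.mul ℝ ℝ).holder 2 w (sobolevEmbedding hs hs' g) := rfl
  rw [h]
  filter_upwards [(ContinuousLinearMap.mul ℝ ℝ).coeFn_holder (r := 2) w
    (sobolevEmbedding hs hs' g), coeFn_sobolevEmbedding hs hs' g] with z h1 h2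
  rw [h1, h2, ContinuousLinearMap.mul_apply']

/-- For a bounded continuous weight the map is the Rellich embedding followed by a bounded
multiplication. Such weights are dense in L^p for finite `p`, and compact operators are closed in
norm. -/
theorem isCompactOperator_weightedEmbedding (hp : p ≠ ⊤) (hs : 2 ≤ s) (hs' : s ≠ ⊤)
    (w : Lp ℝ p (volume.restrict unitDisc)) :
    IsCompactOperator (weightedEmbedding hs hs' w) := by
  refine isCompactOperator_of_dense (weightedEmbedding hs hs')
    (BoundedContinuousFunction.toLp_denseRange ℝ (volume.restrict unitDisc) ℝ hp) ?_ w
  rintro _ ⟨f, rfl⟩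
  let f' := BoundedContinuousFunction.toLp ∞ (volume.restrict unitDisc) ℝ f
  have h : (weightedEmbedding hs hs' (BoundedContinuousFunction.toLp p _ ℝ f) : _ → _) =
      ((ContinuousLinearMap.mul ℝ ℝ).holderL (volume.restrict unitDisc) ∞ 2 2 f') ∘
        discEmbedding := by
    funext g
    refine Lp.ext ((coeFn_weightedEmbedding hs hs' _ g).trans (EventuallyEq.symm ?_))
    filter_upwards [(ContinuousLinearMap.mul ℝ ℝ).coeFn_holder (r := 2) f' (discEmbedding g),
      BoundedContinuousFunction.coeFn_toLp (p := p) (volume.restrict unitDisc) ℝ f,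
      BoundedContinuousFunction.coeFn_toLp (p := ∞) (volume.restrict unitDisc) ℝ f]
      with z h1 h2 h3
    rw [h2, ← h3]
    exact h1
  rw [h]
  exact isCompactOperator_discEmbedding.clm_comp _

/-- A function in `W_0^{1,2}(Ω)` that vanishes has vanishing gradient. -/
theorem W012.snd_eq_zero {Ω : Set ℂ} (hΩ : IsOpen Ω) {w : L2Pairs Ω} (hw : w ∈ W012 Ω)
    (h : w.fst = 0) : w.snd = 0 := by
  have hloc : LocallyIntegrableOn w.snd Ω volume :=
    locallyIntegrableOn_of_locallyIntegrable_restrict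
      ((Lp.memLp w.snd).locallyIntegrable (by norm_num))
  have hweak := W012.hasWeakGradient hw
  -- The weak gradient of zero is orthogonal to all test functions in every direction `e`, so it
  -- vanishes by the fundamental lemma of the calculus of variations.
  have hae := hΩ.ae_eq_zero_of_integral_contDiff_smul_eq_zero hloc fun v hv hc hs => by
    have hint : Integrable (fun z => v z • w.snd z) (volume.restrict Ω) :=
      memLp_one_iff_integrable.1
        ((Lp.memLp w.snd).smul (IsTestFunction.memLp (Ω := Ω) ⟨hv, hc, hs⟩ 2))
    rw [← setIntegral_eq_integral_of_forall_compl_eq_zero (s := Ω) (fun z hz => by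
      rw [image_eq_zero_of_notMem_tsupport (fun h => hz (hs h)), zero_smul])]
    refine ext_inner_right ℝ fun e => ?_
    have h1 := hweak v ⟨hv, hc, hs⟩ e
    have h2 : ∫ z in Ω, w.fst z * fderiv ℝ v z e = 0 := by
      rw [h]
      refine integral_eq_zero_of_ae ?_
      filter_upwards [Lp.coeFn_zero ℝ 2 (volume.restrict Ω)] with z hz
      rw [hz]
      simp
    rw [h2, zero_eq_neg] at h1
    rw [inner_zero_left, real_inner_comm, ← integral_inner hint, ← h1]
    refine integral_congr_ae (Eventually.of_forall fun z => ?_)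
    simp only [inner_smul_right, real_inner_comm]
    ring
  refine Lp.ext ?_
  have h3 : ∀ᵐ z ∂(volume.restrict Ω), w.snd z = 0 :=
    (ae_restrict_iff' hΩ.measurableSet).2 hae
  filter_upwards [h3, Lp.coeFn_zero ℂ 2 (volume.restrict Ω)] with z h4 h5
  rw [h4, h5]
  rfl

theorem weightedEmbedding_injective (hs : 2 ≤ s) (hs' : s ≠ ⊤)
    {w : Lp ℝ p (volume.restrict unitDisc)} (hw : ∀ᵐ z ∂(volume.restrict unitDisc), w z ≠ 0) :
    Function.Injective (weightedEmbedding hs hs' w) := by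
  refine (injective_iff_map_eq_zero _).2 fun g hg => ?_
  have h1 : discEmbedding g = 0 := by
    refine Lp.ext ?_
    have h2 := coeFn_weightedEmbedding hs hs' w g
    rw [hg] at h2
    filter_upwards [h2, Lp.coeFn_zero ℝ 2 (volume.restrict unitDisc), hw] with z h3 h4 h5
    rw [h4] at h3 ⊢
    exact (mul_eq_zero.1 h3.symm).resolve_left h5
  exact Subtype.ext ((discPrimitive_snd g).symm.trans
    (W012.snd_eq_zero isOpen_ball (discPrimitive g).2 h1))

end WeightedEmbedding

end

/-! ### Isometric pull-back of L² spaces under a conformal map. -/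

noncomputable section

section Pullback

open Filter Topology Function
open scoped NNReal

theorem measurableSet_unitDisc : MeasurableSet unitDisc := measurableSet_ball

theorem isOpen_unitDisc : IsOpen unitDisc := isOpen_ball

/-- The exceptional set is the image of a null set under the differentiable inverse map, hence null.
This makes composition with `φ` well defined on classes of functions. -/
theorem IsConformalOnto.ae_comp {φ : ℂ → ℂ} {U V : Set ℂ} (hU : IsOpen U)
    (h : IsConformalOnto φ U V) {P : ℂ → Prop} (hP : ∀ᵐ w ∂(volume.restrict V), P w) :
    ∀ᵐ z ∂(volume.restrict U), P (φ z) := by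
  rw [ae_restrict_iff' hU.measurableSet, ae_iff]
  rw [ae_restrict_iff' (h.isOpen hU).measurableSet, ae_iff] at hP
  have hd : DifferentiableOn ℝ (invFunOn φ U) {w | ¬(w ∈ V → P w)} := by
    have := (h.symm hU).1.restrictScalars ℝ
    exact this.mono fun w hw => by
      simp only [mem_ofPred_eq, Classical.not_imp] at hw
      exact hw.1
  refine measure_mono_null ?_
    (addHaar_image_eq_zero_of_differentiableOn_of_addHaar_eq_zero volume hd hP)
  intro z hz
  simp only [mem_ofPred_eq, Classical.not_imp] at hz
  refine ⟨φ z, ?_, h.2.invOn_invFunOn.1 hz.1⟩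
  simp only [mem_ofPred_eq, Classical.not_imp]
  exact ⟨h.2.mapsTo hz.1, hz.2⟩

theorem IsConformalOnto.lintegral_eq {φ : ℂ → ℂ} {U V : Set ℂ} (hU : IsOpen U)
    (h : IsConformalOnto φ U V) (g : ℂ → ℝ≥0∞) {A : Set ℂ} (hA : MeasurableSet A) (hAU : A ⊆ U) :
    ∫⁻ w in φ '' A, g w = ∫⁻ z in A, ‖deriv φ z‖ₑ ^ 2 * g (φ z) := by
  have hd : ∀ z ∈ A, DifferentiableAt ℂ φ z := fun z hz =>
    h.1.differentiableAt (hU.mem_nhds (hAU hz))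
  rw [lintegral_image_eq_lintegral_abs_det_fderiv_mul volume hA (fun z hz =>
    ((hd z hz).restrictScalars ℝ).hasFDerivAt.hasFDerivWithinAt) (h.2.injOn.mono hAU)]
  refine setLIntegral_congr_fun hA fun z hz => ?_
  have hj := jacobian_eq (hd z hz)
  rw [jacobian] at hj
  simp only [hj]
  rw [abs_of_nonneg (by positivity), ENNReal.ofReal_pow (norm_nonneg _), ofReal_norm]

variable {E : Type*} [NormedField E]

/-- `m` is a measurable weight on `U` of modulus `|φ'|`. -/
structure IsPullbackWeight (φ : ℂ → ℂ) (U : Set ℂ) (m : ℂ → E) : Prop where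
  aestronglyMeasurable : AEStronglyMeasurable m (volume.restrict U)
  norm_eq : ∀ z, ‖m z‖ = ‖deriv φ z‖

/-- `|m|² = |φ'|²` is the Jacobian, so this is the change of variables. The same isometry serves
functions, with `m = |φ'|`, and gradients, with `m` the conjugate of `φ'`. -/
theorem IsConformalOnto.eLpNorm_pullback {φ : ℂ → ℂ} {U V : Set ℂ} (hU : IsOpen U)
    (h : IsConformalOnto φ U V) {m : ℂ → E} (hm : IsPullbackWeight φ U m) (f : ℂ → E) :
    eLpNorm (fun z => m z * f (φ z)) 2 (volume.restrict U) = eLpNorm f 2 (volume.restrict V) := by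
  suffices hsq : eLpNorm (fun z => m z * f (φ z)) 2 (volume.restrict U) ^ 2 =
      eLpNorm f 2 (volume.restrict V) ^ 2 from
    le_antisymm ((ENNReal.pow_le_pow_left_iff two_ne_zero).1 hsq.le)
      ((ENNReal.pow_le_pow_left_iff two_ne_zero).1 hsq.ge)
  simp only [eLpNorm_two_sq]
  conv_rhs => rw [← h.2.image_eq]
  rw [h.lintegral_eq hU _ hU.measurableSet subset_rfl]
  refine lintegral_congr fun z => ?_
  rw [enorm_mul, mul_pow, ← ofReal_norm (m z), hm.norm_eq, ofReal_norm]

variable [MeasurableSpace E] [BorelSpace E] [SecondCountableTopology E]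

theorem IsConformalOnto.aestronglyMeasurable_pullback {φ : ℂ → ℂ} {U V : Set ℂ} (hU : IsOpen U)
    (h : IsConformalOnto φ U V) {m : ℂ → E} (hm : IsPullbackWeight φ U m)
    (f : Lp E 2 (volume.restrict V)) :
    AEStronglyMeasurable (fun z => m z * f (φ z)) (volume.restrict U) :=
  hm.aestronglyMeasurable.mul ((Lp.stronglyMeasurable f).measurable.comp_aemeasurable
    (h.1.continuousOn.aemeasurable hU.measurableSet)).aestronglyMeasurable

theorem IsConformalOnto.memLp_pullback {φ : ℂ → ℂ} {U V : Set ℂ} (hU : IsOpen U)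
    (h : IsConformalOnto φ U V) {m : ℂ → E} (hm : IsPullbackWeight φ U m)
    (f : Lp E 2 (volume.restrict V)) :
    MemLp (fun z => m z * f (φ z)) 2 (volume.restrict U) :=
  ⟨h.aestronglyMeasurable_pullback hU hm f, by
    rw [h.eLpNorm_pullback hU hm]; exact (Lp.memLp f).2⟩

variable [NormedSpace ℝ E] [SMulCommClass ℝ E E]

/-- The isometry `f ↦ m (f ∘ φ)` of `L²(V)` into `L²(U)`, where `φ` maps `U` conformally onto `V`
and `|m| = |φ'|`. -/
def IsConformalOnto.pullback {φ : ℂ → ℂ} {U V : Set ℂ} (hU : IsOpen U)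
    (h : IsConformalOnto φ U V) {m : ℂ → E} (hm : IsPullbackWeight φ U m) :
    Lp E 2 (volume.restrict V) →ₗᵢ[ℝ] Lp E 2 (volume.restrict U) where
  toFun f := (h.memLp_pullback hU hm f).toLp
  map_add' f g := by
    rw [← MemLp.toLp_add]
    refine MemLp.toLp_congr _ _ ?_
    filter_upwards [h.ae_comp hU (Lp.coeFn_add f g)] with z hz
    rw [hz, Pi.add_apply, mul_add]
    rfl
  map_smul' c f := by
    rw [RingHom.id_apply, ← MemLp.toLp_const_smul]
    refine MemLp.toLp_congr _ _ ?_
    filter_upwards [h.ae_comp hU (Lp.coeFn_smul c f)] with z hz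
    rw [hz, Pi.smul_apply, Pi.smul_apply]
    exact mul_smul_comm c _ _
  norm_map' f := by
    change ‖(h.memLp_pullback hU hm f).toLp‖ = ‖f‖
    rw [Lp.norm_toLp, h.eLpNorm_pullback hU hm, Lp.norm_def]

theorem IsConformalOnto.coeFn_pullback {φ : ℂ → ℂ} {U V : Set ℂ} (hU : IsOpen U)
    (h : IsConformalOnto φ U V) {m : ℂ → E} (hm : IsPullbackWeight φ U m)
    (f : Lp E 2 (volume.restrict V)) :
    h.pullback hU hm f =ᵐ[volume.restrict U] fun z => m z * f (φ z) :=
  (h.memLp_pullback hU hm f).coeFn_toLp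

theorem isPullbackWeight_norm_deriv (φ : ℂ → ℂ) (U : Set ℂ) :
    IsPullbackWeight φ U fun z => ‖deriv φ z‖ :=
  ⟨(measurable_deriv φ).norm.aestronglyMeasurable, fun _ => norm_norm _⟩

theorem isPullbackWeight_conj_deriv (φ : ℂ → ℂ) (U : Set ℂ) :
    IsPullbackWeight φ U fun z => (starRingEnd ℂ) (deriv φ z) :=
  ⟨(Complex.continuous_conj.measurable.comp (measurable_deriv φ)).aestronglyMeasurable,
    fun _ => RCLike.norm_conj _⟩

section

variable {φ : ℂ → ℂ} {U V : Set ℂ}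

/-- The pull-back of functions under a conformal map, weighted by `|φ'|`. -/
def IsConformalOnto.pullFun (hU : IsOpen U) (h : IsConformalOnto φ U V) :
    Lp ℝ 2 (volume.restrict V) →ₗᵢ[ℝ] Lp ℝ 2 (volume.restrict U) :=
  h.pullback hU (isPullbackWeight_norm_deriv φ U)

/-- The pull-back of gradients under a conformal map. -/
def IsConformalOnto.pullGrad (hU : IsOpen U) (h : IsConformalOnto φ U V) :
    Lp ℂ 2 (volume.restrict V) →ₗᵢ[ℝ] Lp ℂ 2 (volume.restrict U) :=
  h.pullback hU (isPullbackWeight_conj_deriv φ U)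

theorem IsConformalOnto.pullGrad_pair (hU : IsOpen U) (h : IsConformalOnto φ U V) {u : ℂ → ℝ}
    (hu : IsTestFunction V u) :
    h.pullGrad hU hu.pair.snd = (hu.comp_conformal hU h).pair.snd := by
  refine Lp.ext ((h.coeFn_pullback hU (isPullbackWeight_conj_deriv φ U) _).trans ?_)
  have h1 : hu.pair.snd =ᵐ[volume.restrict V] gradient u := (hu.memLp_gradient 2).coeFn_toLp
  have h2 : (hu.comp_conformal hU h).pair.snd =ᵐ[volume.restrict U]
      gradient (U.indicator (u ∘ φ)) := ((hu.comp_conformal hU h).memLp_gradient 2).coeFn_toLp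
  filter_upwards [h.ae_comp hU h1, h2, ae_restrict_mem hU.measurableSet] with z h3 h4 h5
  rw [h3, h4, gradient_indicator_comp_conformal hU h.1 (hu.1.differentiable (by simp)) h5]

theorem IsConformalOnto.coeFn_pullFun_pair (hU : IsOpen U) (h : IsConformalOnto φ U V) {u : ℂ → ℝ}
    (hu : IsTestFunction V u) :
    h.pullFun hU hu.pair.fst =ᵐ[volume.restrict U]
      fun z => ‖deriv φ z‖ * (hu.comp_conformal hU h).pair.fst z := by
  refine (h.coeFn_pullback hU (isPullbackWeight_norm_deriv φ U) _).trans ?_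
  have h1 : hu.pair.fst =ᵐ[volume.restrict V] u := (hu.memLp 2).coeFn_toLp
  have h2 : (hu.comp_conformal hU h).pair.fst =ᵐ[volume.restrict U]
      U.indicator (u ∘ φ) := ((hu.comp_conformal hU h).memLp 2).coeFn_toLp
  filter_upwards [h.ae_comp hU h1, h2, ae_restrict_mem hU.measurableSet] with z h3 h4 h5
  rw [h3, h4, indicator_of_mem h5]
  rfl

end

end Pullback

end

/-! ### Identification of the Sobolev spaces of `Ω` and of the disc. -/

noncomputable section

section Transfer

open Filter Topology Function
open scoped NNReal

variable {φ : ℂ → ℂ} {Ω : Set ℂ}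

theorem IsTestFunction.pair_snd_mem {u : ℂ → ℝ} (hu : IsTestFunction unitDisc u) :
    hu.pair.snd ∈ DiscGradients :=
  ⟨⟨hu.pair, testPairs_subset_W012 _ hu.pair_mem⟩, rfl⟩

/-- Membership in `K` is part of the closed condition, so a relation checked on test functions
extends to limits together with the fact that the limit is a gradient. -/
theorem isClosed_graph_submodule {L W : Type*} [NormedAddCommGroup L] [NormedSpace ℝ L]
    [NormedAddCommGroup W] [NormedSpace ℝ W] {K : Submodule ℝ L} (hK : IsClosed (K : Set L))
    (J : K →L[ℝ] W) : IsClosed {x : W × L | ∃ h : x.2 ∈ K, x.1 = J ⟨x.2, h⟩} := by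
  rw [← isSeqClosed_iff_isClosed]
  intro x a hx ha
  have ha1 : Tendsto (fun n => (x n).1) atTop (𝓝 a.1) := (continuous_fst.tendsto a).comp ha
  have ha2 : Tendsto (fun n => (x n).2) atTop (𝓝 a.2) := (continuous_snd.tendsto a).comp ha
  have hmem : a.2 ∈ K := hK.mem_of_tendsto ha2 (Eventually.of_forall fun n => (hx n).1)
  refine ⟨hmem, tendsto_nhds_unique ha1 ?_⟩
  have h3 : Tendsto (fun n => (⟨(x n).2, (hx n).1⟩ : K)) atTop (𝓝 ⟨a.2, hmem⟩) :=
    tendsto_subtype_rng.2 ha2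
  exact ((J.continuous.tendsto _).comp h3).congr fun n => (hx n).2.symm

/-- `J` maps a gradient `∇u` to `|φ'| u`. -/
def IsWeightedBy (φ : ℂ → ℂ)
    (J : DiscGradients →L[ℝ] Lp ℝ 2 (volume.restrict unitDisc)) : Prop :=
  ∀ g, J g =ᵐ[volume.restrict unitDisc] fun z => ‖deriv φ z‖ * discEmbedding g z

/-- For a test function this is the chain rule for `u ∘ φ`. Both pull-backs are continuous and the
graph of `J` is closed, so it extends to `W012 Ω`. -/
theorem IsWeightedBy.pullFun_eq {J : DiscGradients →L[ℝ] Lp ℝ 2 (volume.restrict unitDisc)}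
    (hJ : IsWeightedBy φ J) (h : IsConformalOnto φ unitDisc Ω) {w : L2Pairs Ω}
    (hw : w ∈ W012 Ω) : ∃ hg : h.pullGrad isOpen_unitDisc w.snd ∈ DiscGradients,
      h.pullFun isOpen_unitDisc w.fst = J ⟨h.pullGrad isOpen_unitDisc w.snd, hg⟩ := by
  have hw' : w ∈ closure (testPairs Ω) := by rw [← coe_W012]; exact hw
  let Ψ : L2Pairs Ω → Lp ℝ 2 (volume.restrict unitDisc) × Lp ℂ 2 (volume.restrict unitDisc) :=
    fun w => (h.pullFun isOpen_unitDisc w.fst, h.pullGrad isOpen_unitDisc w.snd)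
  have hΨ : Continuous Ψ :=
    ((h.pullFun isOpen_unitDisc).continuous.comp (WithLp.continuous_fst 2 _ _)).prodMk
      ((h.pullGrad isOpen_unitDisc).continuous.comp (WithLp.continuous_snd 2 _ _))
  refine closure_minimal (t := Ψ ⁻¹' _) ?_
    ((isClosed_graph_submodule (K := DiscGradients) isClosed_range_discGradient J).preimage hΨ) hw'
  intro w hw
  obtain ⟨u, hu, rfl⟩ := mem_testPairs_iff.1 hw
  have hv := hu.comp_conformal isOpen_unitDisc h
  have hg : h.pullGrad isOpen_unitDisc hu.pair.snd = hv.pair.snd := h.pullGrad_pair _ hu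
  have hmem : h.pullGrad isOpen_unitDisc hu.pair.snd ∈ DiscGradients := hg ▸ hv.pair_snd_mem
  refine ⟨hmem, Lp.ext ?_⟩
  change h.pullFun isOpen_unitDisc hu.pair.fst =ᵐ[volume.restrict unitDisc]
    J ⟨h.pullGrad isOpen_unitDisc hu.pair.snd, hmem⟩
  refine (h.coeFn_pullFun_pair isOpen_unitDisc hu).trans (EventuallyEq.symm ?_)
  refine (hJ _).trans (Eventually.of_forall fun z => ?_)
  have e1 : (⟨h.pullGrad isOpen_unitDisc hu.pair.snd, hmem⟩ : DiscGradients) =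
    ⟨hv.pair.snd, hv.pair_snd_mem⟩ := Subtype.ext hg
  simp only [e1, discEmbedding_eq, discPrimitive_pair hv]

/-- Composition with the conformal map identifies `W_0^{1,2}(Ω)` with `W_0^{1,2}` of the disc. -/
theorem IsWeightedBy.exists_equiv {J : DiscGradients →L[ℝ] Lp ℝ 2 (volume.restrict unitDisc)}
    (hJ : IsWeightedBy φ J) (h : IsConformalOnto φ unitDisc Ω) :
    ∃ e : W012 Ω ≃ₗ[ℝ] DiscGradients,
      (∀ u v : W012 Ω, inner ℝ u.1.snd v.1.snd = inner ℝ (e u) (e v)) ∧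
      ∀ u v : W012 Ω, inner ℝ u.1.fst v.1.fst = inner ℝ (J (e u)) (J (e v)) := by
  let L : W012 Ω →L[ℝ] Lp ℂ 2 (volume.restrict unitDisc) :=
    (h.pullGrad isOpen_unitDisc).toContinuousLinearMap ∘L (WithLp.sndL 2 ℝ _ _) ∘L
      (W012 Ω).subtypeL
  have hLmem : ∀ x, L x ∈ DiscGradients := fun x => (hJ.pullFun_eq h x.2).1
  have hLfun : ∀ x : W012 Ω, h.pullFun isOpen_unitDisc x.1.fst = J ⟨L x, hLmem x⟩ :=
    fun x => (hJ.pullFun_eq h x.2).2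
  have hnorm : ∀ x : W012 Ω, ‖x.1.snd‖ = ‖L x‖ := fun x =>
    ((h.pullGrad isOpen_unitDisc).norm_map _).symm
  -- Boundedness of `J` acts as a Poincaré inequality on `Ω`, which need not be bounded. It makes
  -- `L` injective with closed range.
  have hanti : AntilipschitzWith (‖J‖₊ + 1) L := by
    refine AddMonoidHomClass.antilipschitz_of_bound _ fun x => ?_
    have h1 : ‖x.1.fst‖ ≤ ‖J‖ * ‖L x‖ := by
      rw [← (h.pullFun isOpen_unitDisc).norm_map, hLfun]
      exact J.le_opNorm _
    have h2 : ‖x.1‖ ^ 2 = ‖x.1.fst‖ ^ 2 + ‖x.1.snd‖ ^ 2 := WithLp.prod_norm_sq_eq_of_L2 _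
    have hJ0 : 0 ≤ ‖J‖ := J.opNorm_nonneg
    have h3 : ‖x‖ ^ 2 ≤ ((‖J‖ + 1 : ℝ) * ‖L x‖) ^ 2 := by
      change ‖x.1‖ ^ 2 ≤ _
      rw [h2, hnorm]
      have h4 : ‖x.1.fst‖ ^ 2 ≤ (‖J‖ * ‖L x‖) ^ 2 := by gcongr
      nlinarith [mul_nonneg hJ0 (sq_nonneg ‖L x‖)]
    exact le_of_sq_le_sq h3 (by positivity)
  have hclosed : IsClosed (range L) := hanti.isClosed_range L.uniformContinuous
  -- The closed range contains the gradient of every test function `v` of the disc, since `v` is the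
  -- composition of `v ∘ φ⁻¹` with `φ`.
  have hsurj : ∀ g ∈ DiscGradients, g ∈ range L := by
    rintro _ ⟨w, rfl⟩
    have hw' : w.1 ∈ closure (testPairs unitDisc) := by rw [← coe_W012]; exact w.2
    refine closure_minimal (t := (fun w : L2Pairs unitDisc => w.snd) ⁻¹' range L) ?_
      (hclosed.preimage (WithLp.continuous_snd 2 _ _)) hw'
    intro w hw
    obtain ⟨v, hv, rfl⟩ := mem_testPairs_iff.1 hw
    have hu := hv.comp_conformal (h.isOpen isOpen_unitDisc) (h.symm isOpen_unitDisc)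
    refine ⟨⟨hu.pair, testPairs_subset_W012 _ hu.pair_mem⟩, ?_⟩
    change h.pullGrad isOpen_unitDisc hu.pair.snd = hv.pair.snd
    rw [h.pullGrad_pair isOpen_unitDisc hu]
    have hvv : unitDisc.indicator (Ω.indicator (v ∘ invFunOn φ unitDisc) ∘ φ) = v := by
      funext z
      by_cases hz : z ∈ unitDisc
      · rw [indicator_of_mem hz, comp_apply, indicator_of_mem (h.2.mapsTo hz), comp_apply,
          h.2.invOn_invFunOn.1 hz]
      · rw [indicator_of_notMem hz, image_eq_zero_of_notMem_tsupport fun h => hz (hv.2.2 h)]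
    congr 2
  let L' : W012 Ω →ₗ[ℝ] DiscGradients := (L : W012 Ω →ₗ[ℝ] _).codRestrict DiscGradients hLmem
  have hL' : Bijective L' := by
    refine ⟨fun x y hxy => hanti.injective (congrArg Subtype.val hxy), fun g => ?_⟩
    obtain ⟨x, hx⟩ := hsurj g.1 g.2
    exact ⟨x, Subtype.ext hx⟩
  let e : W012 Ω ≃ₗ[ℝ] DiscGradients := LinearEquiv.ofBijective L' hL'
  refine ⟨e, fun u v => ?_, fun u v => ?_⟩
  · exact ((h.pullGrad isOpen_unitDisc).inner_map_map u.1.snd v.1.snd).symm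
  · rw [← (h.pullFun isOpen_unitDisc).inner_map_map u.1.fst v.1.fst, hLfun, hLfun]
    rfl

end Transfer

end

/-! ### Hölder estimate, measure variation, and infinite dimension. -/

noncomputable section

section Estimates

open Filter Topology Function
open scoped NNReal

/-- `s` is given by `1/s = 1/2 - 1/p`, which gives `s = 2` for `p = ∞`. Splitting `u²` evenly in L^s
then requires `u` in L^{2s}. -/
theorem exists_holder_exponent {p : ℝ≥0∞} (hp : 2 < p) :
    ∃ s : ℝ≥0∞, 2 ≤ s ∧ s ≠ ⊤ ∧ ENNReal.HolderTriple p s 2 ∧ sobolevExponent p = 2 * s := by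
  have hp' : p⁻¹ < 2⁻¹ := ENNReal.inv_lt_inv.2 hp
  refine ⟨(2⁻¹ - p⁻¹)⁻¹, ?_, ?_, ⟨?_⟩, ?_⟩
  · rw [ENNReal.le_inv_iff_le_inv]
    exact tsub_le_self
  · rw [ENNReal.inv_ne_top]
    exact (tsub_pos_of_lt hp').ne'
  · rw [inv_inv]
    exact add_tsub_cancel_of_le hp'.le
  · rw [sobolevExponent]
    split_ifs with h
    · rw [h]
      norm_num
    · lift p to ℝ≥0 using h
      have h2 : (2 : ℝ≥0) < p := by exact_mod_cast hp
      have h0 : (0 : ℝ≥0) < p := lt_trans (by norm_num) h2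
      have e1 : (4 * p / (p - 2) : ℝ≥0) = 2 * (2⁻¹ - p⁻¹)⁻¹ := by
        have h3 : (2⁻¹ - p⁻¹ : ℝ≥0) = (p - 2) / (2 * p) := by
          have h4 : p⁻¹ ≤ (2⁻¹ : ℝ≥0) := by gcongr
          apply NNReal.coe_injective
          push_cast [NNReal.coe_sub h4, NNReal.coe_sub h2.le]
          have : (p : ℝ) ≠ 0 := by exact_mod_cast h0.ne'
          field_simp
        rw [h3, inv_div]
        ring
      have h5 : (p - 2 : ℝ≥0) ≠ 0 := (tsub_pos_of_lt h2).ne'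
      have h6 : (2⁻¹ - p⁻¹ : ℝ≥0) ≠ 0 := (tsub_pos_of_lt (by gcongr)).ne'
      have e2 := congrArg ((↑) : ℝ≥0 → ℝ≥0∞) e1
      rw [ENNReal.coe_div h5] at e2
      push_cast [ENNReal.coe_inv h6, ENNReal.coe_inv h0.ne', ENNReal.coe_inv two_ne_zero] at e2
      exact e2

theorem exists_isWeightedBy {φ : ℂ → ℂ} {Ω : Set ℂ} (h : IsConformalOnto φ unitDisc Ω)
    {p : ℝ≥0∞} (hp : 2 < p) (hφ : MemLp (fun z => ‖deriv φ z‖) p (volume.restrict unitDisc)) :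
    ∃ J, IsWeightedBy φ J ∧ IsCompactOperator J ∧ Injective J := by
  -- Density of bounded continuous weights needs a finite exponent, so `p` is lowered to at most 3;
  -- any finite number above 2 would do.
  have hp₀ : 2 < min p 3 := lt_min hp (by norm_num)
  have hp₁ : min p 3 ≠ ⊤ := ((min_le_right _ _).trans_lt (by norm_num)).ne
  obtain ⟨s, hs, hs', hHolder, -⟩ := exists_holder_exponent hp₀
  have hw : MemLp (fun z => ‖deriv φ z‖) (min p 3) (volume.restrict unitDisc) :=
    hφ.mono_exponent (min_le_left _ _)
  have : Fact (1 ≤ min p 3) := ⟨le_trans (by norm_num) hp₀.le⟩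
  have : Fact (1 ≤ s) := ⟨le_trans (by norm_num) hs⟩
  refine ⟨weightedEmbedding hs hs' hw.toLp, fun g => ?_,
    isCompactOperator_weightedEmbedding hp₁ hs hs' _, weightedEmbedding_injective hs hs' ?_⟩
  · filter_upwards [coeFn_weightedEmbedding hs hs' hw.toLp g, hw.coeFn_toLp] with z h1 h2
    rw [h1, h2]
  · filter_upwards [hw.coeFn_toLp, ae_restrict_mem measurableSet_unitDisc] with z h1 h2
    rw [h1]
    exact norm_ne_zero_iff.2 (h.deriv_ne_zero isOpen_unitDisc h2)

theorem discNorm_nonneg {E : Type*} [NormedAddCommGroup E] (f : ℂ → E) (r : ℝ≥0∞) :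
    0 ≤ discNorm f r :=
  ENNReal.toReal_nonneg

/-- The difference is `∫ (a - b)(a + b) u u`. Hölder is applied three times: `1 = 1/2 + 1/2`, then
`1/2 = 1/p + 1/s`, then `1/s = 1/q + 1/q`. -/
theorem inner_self_sub_inner_self_le {φ₁ φ₂ : ℂ → ℂ} {p : ℝ≥0∞} (hp : 2 < p)
    (hφ₁ : MemLp (fun z => ‖deriv φ₁ z‖) p (volume.restrict unitDisc))
    (hφ₂ : MemLp (fun z => ‖deriv φ₂ z‖) p (volume.restrict unitDisc))
    {J₁ J₂ : DiscGradients →L[ℝ] Lp ℝ 2 (volume.restrict unitDisc)}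
    (hJ₁ : IsWeightedBy φ₁ J₁) (hJ₂ : IsWeightedBy φ₂ J₂) (g : DiscGradients) :
    |inner ℝ (J₁ g) (J₁ g) - inner ℝ (J₂ g) (J₂ g)| ≤
      sobolevConst (sobolevExponent p) ^ 2 * (discNorm (deriv φ₁) p + discNorm (deriv φ₂) p) *
        discNorm (fun z => ‖deriv φ₁ z‖ - ‖deriv φ₂ z‖) 2 * ‖g‖ ^ 2 := by
  obtain ⟨s, hs, hs', hHolder, hq⟩ := exists_holder_exponent hp
  set q := sobolevExponent p
  have hq2 : 2 ≤ q := hq ▸ hs.trans (le_mul_of_one_le_left' (by norm_num))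
  have hq' : q ≠ ⊤ := hq ▸ ENNReal.mul_ne_top (by norm_num) hs'
  have hqs : ENNReal.HolderTriple q q s := ⟨by
    rw [hq, ENNReal.mul_inv (Or.inl two_ne_zero) (Or.inl (by norm_num)), ← add_mul,
      ENNReal.inv_two_add_inv_two, one_mul]⟩
  let μ : Measure ℂ := volume.restrict unitDisc
  set a : ℂ → ℝ := fun z => ‖deriv φ₁ z‖
  set b : ℂ → ℝ := fun z => ‖deriv φ₂ z‖
  set u : ℂ → ℝ := (discEmbedding g : ℂ → ℝ)
  have hu : AEStronglyMeasurable u μ := Lp.aestronglyMeasurable _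
  have hu2 : AEStronglyMeasurable (u • u) μ := hu.smul hu
  have hab : AEStronglyMeasurable (a + b) μ := hφ₁.1.add hφ₂.1
  have hsub : MemLp (a - b) 2 μ := (hφ₁.sub hφ₂).mono_exponent hp.le
  have h1 : inner ℝ (J₁ g) (J₁ g) - inner ℝ (J₂ g) (J₂ g) =
      ∫ z, ((a - b) • (a + b) • u • u) z ∂μ := by
    have e : inner ℝ (J₁ g) (J₁ g) - inner ℝ (J₂ g) (J₂ g) =
        inner ℝ (J₁ g - J₂ g) (J₁ g + J₂ g) := by
      rw [inner_sub_left, inner_add_right, inner_add_right, real_inner_comm (J₁ g) (J₂ g)]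
      ring
    rw [e, L2.inner_def]
    refine integral_congr_ae ?_
    filter_upwards [Lp.coeFn_sub (J₁ g) (J₂ g), Lp.coeFn_add (J₁ g) (J₂ g), hJ₁ g, hJ₂ g]
      with z h1 h2 h3 h4
    rw [h1, h2, Pi.sub_apply, Pi.add_apply, h3, h4]
    simp [a, b, u]
    ring
  have h2 : ‖∫ z, ((a - b) • (a + b) • u • u) z ∂μ‖ₑ ≤
      ENNReal.ofReal (discNorm (a - b) 2) * (ENNReal.ofReal (discNorm (deriv φ₁) p +
        discNorm (deriv φ₂) p) * (ENNReal.ofReal (sobolevConst q * ‖g‖) *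
          ENNReal.ofReal (sobolevConst q * ‖g‖))) := by
    have hn₁ : eLpNorm a p μ = ENNReal.ofReal (discNorm (deriv φ₁) p) := by
      have := hφ₁.2.ne
      rw [eLpNorm_norm] at this
      rw [discNorm, ENNReal.ofReal_toReal this]
      exact eLpNorm_norm _
    have hn₂ : eLpNorm b p μ = ENNReal.ofReal (discNorm (deriv φ₂) p) := by
      have := hφ₂.2.ne
      rw [eLpNorm_norm] at this
      rw [discNorm, ENNReal.ofReal_toReal this]
      exact eLpNorm_norm _
    calc ‖∫ z, ((a - b) • (a + b) • u • u) z ∂μ‖ₑ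
        ≤ eLpNorm ((a - b) • (a + b) • u • u) 1 μ := by
          rw [eLpNorm_one_eq_lintegral_enorm]
          exact enorm_integral_le_lintegral_enorm _
      _ ≤ eLpNorm (a - b) 2 μ * eLpNorm ((a + b) • u • u) 2 μ :=
          eLpNorm_smul_le_mul_eLpNorm (hab.smul hu2) hsub.1
      _ ≤ eLpNorm (a - b) 2 μ * (eLpNorm (a + b) p μ * eLpNorm (u • u) s μ) := by
          gcongr
          exact eLpNorm_smul_le_mul_eLpNorm hu2 hab
      _ ≤ eLpNorm (a - b) 2 μ * ((eLpNorm a p μ + eLpNorm b p μ) *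
            (eLpNorm u q μ * eLpNorm u q μ)) := by
          gcongr
          · exact eLpNorm_add_le hφ₁.1 hφ₂.1 (le_trans (by norm_num) hp.le)
          · exact eLpNorm_smul_le_mul_eLpNorm hu hu
      _ ≤ _ := by
          rw [hn₁, hn₂, ← ENNReal.ofReal_add (discNorm_nonneg _ _) (discNorm_nonneg _ _),
            show ENNReal.ofReal (discNorm (a - b) 2) = eLpNorm (a - b) 2 μ from
              ENNReal.ofReal_toReal hsub.2.ne]
          gcongr
          · exact eLpNorm_discEmbedding_le hq2 hq' g
          · exact eLpNorm_discEmbedding_le hq2 hq' g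
  have hC := sobolevConst_nonneg q
  have hs0 := add_nonneg (discNorm_nonneg (deriv φ₁) p) (discNorm_nonneg (deriv φ₂) p)
  have hd0 := discNorm_nonneg (a - b) 2
  rw [← ENNReal.ofReal_mul (by positivity), ← ENNReal.ofReal_mul hs0,
    ← ENNReal.ofReal_mul hd0, ← ofReal_norm, ENNReal.ofReal_le_ofReal_iff (by positivity)] at h2
  rw [h1, ← Real.norm_eq_abs]
  refine h2.trans_eq ?_
  change discNorm (a - b) 2 * _ = _ * discNorm (a - b) 2 * _
  ring

theorem IsConformalOnto.volume_real_image {φ : ℂ → ℂ} {Ω : Set ℂ}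
    (h : IsConformalOnto φ unitDisc Ω) {A : Set ℂ} (hA : MeasurableSet A) (hAD : A ⊆ unitDisc) :
    volume.real (φ '' A) = ∫ z in A, ‖deriv φ z‖ ^ 2 := by
  rw [integral_eq_lintegral_of_nonneg_ae (Eventually.of_forall fun z => by positivity)
    ((measurable_deriv φ).norm.pow_const 2).aestronglyMeasurable, Measure.real]
  congr 1
  rw [← setLIntegral_one, h.lintegral_eq isOpen_unitDisc _ hA hAD]
  refine lintegral_congr fun z => ?_
  rw [mul_one, ENNReal.ofReal_pow (norm_nonneg _), ofReal_norm]

/-- The `L²` distance of the moduli of the derivatives is controlled by the variation of measure. -/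
theorem discNorm_sub_le_sqrt {φ₁ φ₂ : ℂ → ℂ} {Ω₁ Ω₂ : Set ℂ}
    (h₁ : IsConformalOnto φ₁ unitDisc Ω₁) (h₂ : IsConformalOnto φ₂ unitDisc Ω₂)
    (hφ₁ : MemLp (fun z => ‖deriv φ₁ z‖) 2 (volume.restrict unitDisc))
    (hφ₂ : MemLp (fun z => ‖deriv φ₂ z‖) 2 (volume.restrict unitDisc)) :
    discNorm (fun z => ‖deriv φ₁ z‖ - ‖deriv φ₂ z‖) 2 ≤
      √((volume.real (φ₁ '' discPlus φ₁ φ₂) - volume.real (φ₂ '' discPlus φ₁ φ₂)) +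
        (volume.real (φ₂ '' discMinus φ₁ φ₂) - volume.real (φ₁ '' discMinus φ₁ φ₂))) := by
  set a : ℂ → ℝ := fun z => ‖deriv φ₁ z‖
  set b : ℂ → ℝ := fun z => ‖deriv φ₂ z‖
  have ham : Measurable a := (measurable_deriv φ₁).norm
  have hbm : Measurable b := (measurable_deriv φ₂).norm
  have hj₁ : ∀ z ∈ unitDisc, jacobian φ₁ z = a z ^ 2 := fun z hz =>
    jacobian_eq (h₁.1.differentiableAt (isOpen_unitDisc.mem_nhds hz))
  have hj₂ : ∀ z ∈ unitDisc, jacobian φ₂ z = b z ^ 2 := fun z hz =>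
    jacobian_eq (h₂.1.differentiableAt (isOpen_unitDisc.mem_nhds hz))
  have hP : discPlus φ₁ φ₂ = unitDisc ∩ {z | b z ^ 2 ≤ a z ^ 2} := by
    ext z
    refine and_congr_right fun hz => ?_
    rw [hj₁ z hz, hj₂ z hz]
    rfl
  have hM : discMinus φ₁ φ₂ = unitDisc \ {z | b z ^ 2 ≤ a z ^ 2} := by
    ext z
    refine and_congr_right fun hz => ?_
    rw [hj₁ z hz, hj₂ z hz]
    exact not_le.symm
  have hS : MeasurableSet {z | b z ^ 2 ≤ a z ^ 2} :=
    measurableSet_le (hbm.pow_const 2) (ham.pow_const 2)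
  have hPm : MeasurableSet (discPlus φ₁ φ₂) := hP ▸ measurableSet_unitDisc.inter hS
  have hMm : MeasurableSet (discMinus φ₁ φ₂) := hM ▸ measurableSet_unitDisc.diff hS
  have hPD : discPlus φ₁ φ₂ ⊆ unitDisc := fun z hz => hz.1
  have hMD : discMinus φ₁ φ₂ ⊆ unitDisc := fun z hz => hz.1
  have hai : IntegrableOn (fun z => a z ^ 2) unitDisc := hφ₁.integrable_sq
  have hbi : IntegrableOn (fun z => b z ^ 2) unitDisc := hφ₂.integrable_sq
  rw [h₁.volume_real_image hPm hPD, h₂.volume_real_image hPm hPD, h₁.volume_real_image hMm hMD,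
    h₂.volume_real_image hMm hMD, ← integral_sub (hai.mono_set hPD) (hbi.mono_set hPD),
    ← integral_sub (hbi.mono_set hMD) (hai.mono_set hMD)]
  -- On each of the two sets `a² - b²` has a fixed sign, so the two brackets add up to `∫ |a² - b²|`
  -- over the disc.
  have e1 : ∫ z in discPlus φ₁ φ₂, (a z ^ 2 - b z ^ 2) =
      ∫ z in discPlus φ₁ φ₂, |a z ^ 2 - b z ^ 2| :=
    setIntegral_congr_fun hPm fun z hz => by
      rw [hP] at hz
      exact (abs_of_nonneg (sub_nonneg.2 hz.2)).symm
  have e2 : ∫ z in discMinus φ₁ φ₂, (b z ^ 2 - a z ^ 2) =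
      ∫ z in discMinus φ₁ φ₂, |a z ^ 2 - b z ^ 2| :=
    setIntegral_congr_fun hMm fun z hz => by
      rw [hM] at hz
      have : a z ^ 2 < b z ^ 2 := not_le.1 fun h => hz.2 h
      rw [abs_sub_comm, abs_of_nonneg (by linarith)]
  have hint : IntegrableOn (fun z => |a z ^ 2 - b z ^ 2|) unitDisc := (hai.sub hbi).abs
  rw [e1, e2, hP, hM, integral_inter_add_sdiff hS hint]
  refine Real.le_sqrt_of_sq_le ?_
  have hsub : MemLp (fun z => a z - b z) 2 (volume.restrict unitDisc) := hφ₁.sub hφ₂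
  have e3 : discNorm (fun z => a z - b z) 2 ^ 2 = ∫ z in unitDisc, (a z - b z) ^ 2 := by
    rw [discNorm, ← ENNReal.toReal_pow, eLpNorm_two_sq,
      integral_eq_lintegral_of_nonneg_ae (Eventually.of_forall fun z => by positivity)
        (by fun_prop : Measurable fun z => (a z - b z) ^ 2).aestronglyMeasurable]
    congr 1
    refine lintegral_congr fun z => ?_
    rw [← ofReal_norm, ← ENNReal.ofReal_pow (norm_nonneg _), Real.norm_eq_abs, sq_abs]
  rw [e3]
  refine integral_mono hsub.integrable_sq hint fun z => ?_
  have ha : 0 ≤ a z := norm_nonneg _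
  have hb : 0 ≤ b z := norm_nonneg _
  simp only
  -- Pointwise `|a - b| ≤ a + b`, hence `(a - b)² ≤ |a² - b²|`.
  rw [show a z ^ 2 - b z ^ 2 = (a z - b z) * (a z + b z) by ring, abs_mul,
    abs_of_nonneg (add_nonneg ha hb), ← sq_abs, pow_two]
  gcongr
  rw [abs_le]
  constructor <;> linarith

/-- Bumps with disjoint supports have orthogonal gradients. This supplies the `n`-dimensional
subspace without which there might be no `n`-th eigenvalue. -/
theorem exists_submodule_discGradients (n : ℕ) :
    ∃ E : Submodule ℝ DiscGradients, Module.finrank ℝ E = n := by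
  -- Centres `iδ` with `i < n` and outer radius `δ/3 < δ/2` keep the supports disjoint and inside
  -- the disc.
  set δ : ℝ := 1 / (n + 1) with hδ
  have hδ0 : 0 < δ := by positivity
  let β : (i : Fin n) → ContDiffBump (((i : ℕ) * δ : ℝ) : ℂ) := fun _ =>
    ⟨δ / 4, δ / 3, by positivity, by linarith⟩
  have hout : ∀ i, (β i).rOut = δ / 3 := fun _ => rfl
  have hin : ∀ i, (β i).rIn = δ / 4 := fun _ => rfl
  have hsub : ∀ i : Fin n, closedBall (((i : ℕ) * δ : ℝ) : ℂ) (δ / 3) ⊆ unitDisc := by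
    intro i z hz
    rw [mem_closedBall, dist_eq_norm] at hz
    rw [unitDisc, mem_ball_zero_iff]
    have h1 : ‖(((i : ℕ) * δ : ℝ) : ℂ)‖ = (i : ℕ) * δ := by
      rw [Complex.norm_real, Real.norm_of_nonneg (by positivity)]
    have h2 : ((i : ℕ) : ℝ) + 1 ≤ n := by exact_mod_cast i.2
    have h3 : (n + 1) * δ = 1 := by rw [hδ]; field_simp
    have h4 := norm_sub_norm_le z (((i : ℕ) * δ : ℝ) : ℂ)
    nlinarith
  have htest : ∀ i, IsTestFunction unitDisc (β i) := fun i =>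
    ⟨(β i).contDiff, (β i).hasCompactSupport, by
      rw [(β i).tsupport_eq, hout]
      exact hsub i⟩
  have hdisj : ∀ i j : Fin n, i ≠ j → ∀ z, z ∈ tsupport (β i) → z ∉ tsupport (β j) := by
    intro i j hij z hi hj
    rw [(β i).tsupport_eq, hout, mem_closedBall] at hi
    rw [(β j).tsupport_eq, hout, mem_closedBall] at hj
    have h1 : dist (((i : ℕ) * δ : ℝ) : ℂ) (((j : ℕ) * δ : ℝ) : ℂ) ≤ δ / 3 + δ / 3 :=
      (dist_triangle_left _ _ z).trans (add_le_add hi hj)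
    rw [dist_eq_norm, ← Complex.ofReal_sub, Complex.norm_real, ← sub_mul, norm_mul,
      Real.norm_of_nonneg hδ0.le] at h1
    have h2 : (1 : ℝ) ≤ ‖((i : ℕ) : ℝ) - ((j : ℕ) : ℝ)‖ := by
      have h3 : (1 : ℤ) ≤ |((i : ℕ) : ℤ) - ((j : ℕ) : ℤ)| :=
        Int.one_le_abs (sub_ne_zero.2 fun h => hij (Fin.ext (by exact_mod_cast h)))
      rw [Real.norm_eq_abs]
      exact_mod_cast h3
    nlinarith
  let g : Fin n → DiscGradients := fun i => ⟨(htest i).pair.snd, (htest i).pair_snd_mem⟩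
  -- A vanishing gradient would force its primitive, the bump, to vanish a.e., although it equals 1
  -- on a ball.
  have hg0 : ∀ i, g i ≠ 0 := by
    intro i hi
    have h1 : discEmbedding (g i) = (htest i).pair.fst := by
      rw [discEmbedding_eq, discPrimitive_pair]
    rw [hi, map_zero] at h1
    have h2 : β i =ᵐ[volume.restrict unitDisc] (0 : ℂ → ℝ) := by
      have h3 : (htest i).pair.fst =ᵐ[volume.restrict unitDisc] β i :=
        ((htest i).memLp 2).coeFn_toLp
      rw [← h1] at h3
      exact h3.symm.trans (Lp.coeFn_zero _ _ _)
    have h4 : volume (ball (((i : ℕ) * δ : ℝ) : ℂ) (δ / 4)) = 0 := by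
      have h5 := (ae_restrict_iff' measurableSet_unitDisc).1 h2
      refine measure_mono_null (fun z hz => ?_) h5
      have hz' : z ∈ unitDisc :=
        hsub i (closedBall_subset_closedBall (by linarith) (ball_subset_closedBall hz))
      have h6 : β i z = 1 := (β i).one_of_mem_closedBall (by
        rw [hin]; exact ball_subset_closedBall hz)
      intro h7
      have h8 := h7 hz'
      rw [h6] at h8
      exact one_ne_zero h8
    exact (measure_ball_pos volume _ (by positivity)).ne' h4
  have horth : Pairwise fun i j => inner ℝ (g i) (g j) = 0 := by
    intro i j hij
    change inner ℝ (htest i).pair.snd (htest j).pair.snd = 0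
    rw [L2.inner_def]
    refine integral_eq_zero_of_ae ?_
    have h1 : (htest i).pair.snd =ᵐ[volume.restrict unitDisc] gradient (β i) :=
      ((htest i).memLp_gradient 2).coeFn_toLp
    have h2 : (htest j).pair.snd =ᵐ[volume.restrict unitDisc] gradient (β j) :=
      ((htest j).memLp_gradient 2).coeFn_toLp
    filter_upwards [h1, h2] with z h3 h4
    rw [h3, h4]
    have key : ∀ k, z ∉ tsupport (β k) → gradient (β k) z = 0 := by
      intro k hk
      have : fderiv ℝ (β k) z = 0 := by
        by_contra h
        exact hk (support_fderiv_subset ℝ h)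
      rw [gradient, this, map_zero]
    by_cases hz : z ∈ tsupport (β i)
    · rw [key j (hdisj i j hij z hz), inner_zero_right]
      rfl
    · rw [key i hz, inner_zero_left]
      rfl
  have hli := linearIndependent_of_ne_zero_of_inner_eq_zero hg0 horth
  exact ⟨Submodule.span ℝ (range g), by simpa using finrank_span_eq_card hli⟩

end Estimates

end

/-! ### From reciprocals to eigenvalues, and the conclusion. -/

/-- Multiply by `x y`, which is at most the larger of the two squares; `δ ≥ 0` because the two
left-hand sides sum to zero. -/
theorem abs_sub_le_of_inv_sub_inv_le {x y δ : ℝ} (hx : 0 < x) (hy : 0 < y) (h₁ : x⁻¹ - y⁻¹ ≤ δ)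
    (h₂ : y⁻¹ - x⁻¹ ≤ δ) : |x - y| ≤ max (x ^ 2) (y ^ 2) * δ := by
  have hδ : 0 ≤ δ := by linarith
  have hxy : x * y ≤ max (x ^ 2) (y ^ 2) := by
    rcases le_total x y with h | h
    · exact le_max_of_le_right (by nlinarith)
    · exact le_max_of_le_left (by nlinarith)
  refine le_trans ?_ (mul_le_mul_of_nonneg_right hxy hδ)
  have e1 : x * y * (x⁻¹ - y⁻¹) = y - x := by field_simp
  have e2 : x * y * (y⁻¹ - x⁻¹) = x - y := by field_simp
  rw [abs_le]
  constructor
  · have := mul_le_mul_of_nonneg_left h₁ (mul_pos hx hy).le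
    linarith
  · have := mul_le_mul_of_nonneg_left h₂ (mul_pos hx hy).le
    linarith

theorem theorem4 (φ₁ φ₂ : ℂ → ℂ) (Ω₁ Ω₂ : Set ℂ)
    (h₁ : IsConformalOnto φ₁ unitDisc Ω₁) (h₂ : IsConformalOnto φ₂ unitDisc Ω₂)
    (p : ℝ≥0∞) (hp : 2 < p)
    (hφ₁ : MemLp (fun z => ‖deriv φ₁ z‖) p (volume.restrict unitDisc))
    (hφ₂ : MemLp (fun z => ‖deriv φ₂ z‖) p (volume.restrict unitDisc))
    (n : ℕ) (hn : 1 ≤ n) :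
    -- the `n`-th eigenvalues exist and are positive
    (IsLeast (dirichletLevels Ω₁ n) (dirichletEigenvalue Ω₁ n) ∧ 0 < dirichletEigenvalue Ω₁ n) ∧
    (IsLeast (dirichletLevels Ω₂ n) (dirichletEigenvalue Ω₂ n) ∧ 0 < dirichletEigenvalue Ω₂ n) ∧
    -- the estimate through the derivatives
    |dirichletEigenvalue Ω₁ n - dirichletEigenvalue Ω₂ n| ≤
      max (dirichletEigenvalue Ω₁ n ^ 2) (dirichletEigenvalue Ω₂ n ^ 2) *
        sobolevConst (sobolevExponent p) ^ 2 *
        (discNorm (deriv φ₁) p + discNorm (deriv φ₂) p) *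
        discNorm (fun z => ‖deriv φ₁ z‖ - ‖deriv φ₂ z‖) 2 ∧
    -- the estimate through the measure variation
    |dirichletEigenvalue Ω₁ n - dirichletEigenvalue Ω₂ n| ≤
      max (dirichletEigenvalue Ω₁ n ^ 2) (dirichletEigenvalue Ω₂ n ^ 2) *
        sobolevConst (sobolevExponent p) ^ 2 *
        (discNorm (deriv φ₁) p + discNorm (deriv φ₂) p) *
        √((volume.real (φ₁ '' discPlus φ₁ φ₂) - volume.real (φ₂ '' discPlus φ₁ φ₂)) +
          (volume.real (φ₂ '' discMinus φ₁ φ₂) - volume.real (φ₁ '' discMinus φ₁ φ₂))) := by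
  obtain ⟨J₁, hJ₁, hc₁, hi₁⟩ := exists_isWeightedBy h₁ hp hφ₁
  obtain ⟨J₂, hJ₂, hc₂, hi₂⟩ := exists_isWeightedBy h₂ hp hφ₂
  obtain ⟨e₁, hg₁, hf₁⟩ := hJ₁.exists_equiv h₁
  obtain ⟨e₂, hg₂, hf₂⟩ := hJ₂.exists_equiv h₂
  have hV := exists_submodule_discGradients n
  have hl₁ := dirichletLevels_eq_spectralLevels e₁ J₁ hg₁ hf₁ n
  have hl₂ := dirichletLevels_eq_spectralLevels e₂ J₂ hg₂ hf₂ n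
  have hT₁ := isSymmetric_gramOperator J₁
  have hT₂ := isSymmetric_gramOperator J₂
  have hTc₁ := isCompactOperator_gramOperator hc₁
  have hTc₂ := isCompactOperator_gramOperator hc₂
  have hpos₁ := fun x (hx : x ≠ 0) => inner_gramOperator_pos hi₁ hx
  have hpos₂ := fun x (hx : x ≠ 0) => inner_gramOperator_pos hi₂ hx
  have hL₁ := isLeast_spectralLevels hT₁ hTc₁ hpos₁ hn hV
  have hL₂ := isLeast_spectralLevels hT₂ hTc₂ hpos₂ hn hV
  have hδ := inner_self_sub_inner_self_le hp hφ₁ hφ₂ hJ₁ hJ₂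
  set δ := sobolevConst (sobolevExponent p) ^ 2 *
    (discNorm (deriv φ₁) p + discNorm (deriv φ₂) p) *
    discNorm (fun z => ‖deriv φ₁ z‖ - ‖deriv φ₂ z‖) 2 with hδ_def
  have hd₁ := inv_sInf_spectralLevels_sub_le hT₁ hT₂ hTc₁ hTc₂ hpos₁ hpos₂ hn hV
    (δ := δ) fun x => by
      rw [inner_gramOperator_left, inner_gramOperator_left]
      exact (le_abs_self _).trans (hδ x)
  have hd₂ := inv_sInf_spectralLevels_sub_le hT₂ hT₁ hTc₂ hTc₁ hpos₂ hpos₁ hn hV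
    (δ := δ) fun x => by
      rw [inner_gramOperator_left, inner_gramOperator_left]
      exact (le_abs_self _).trans ((abs_sub_comm _ _).trans_le (hδ x))
  -- The infima of the spectral levels are the Dirichlet eigenvalues, since the sets of levels
  -- coincide.
  rw [← hl₁] at hL₁ hd₁ hd₂
  rw [← hl₂] at hL₂ hd₁ hd₂
  change IsLeast _ (dirichletEigenvalue Ω₁ n) ∧ 0 < dirichletEigenvalue Ω₁ n at hL₁
  change IsLeast _ (dirichletEigenvalue Ω₂ n) ∧ 0 < dirichletEigenvalue Ω₂ n at hL₂
  change (dirichletEigenvalue Ω₁ n)⁻¹ - (dirichletEigenvalue Ω₂ n)⁻¹ ≤ δ at hd₁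
  change (dirichletEigenvalue Ω₂ n)⁻¹ - (dirichletEigenvalue Ω₁ n)⁻¹ ≤ δ at hd₂
  have hest : |dirichletEigenvalue Ω₁ n - dirichletEigenvalue Ω₂ n| ≤
      max (dirichletEigenvalue Ω₁ n ^ 2) (dirichletEigenvalue Ω₂ n ^ 2) * δ :=
    abs_sub_le_of_inv_sub_inv_le hL₁.2 hL₂.2 hd₁ hd₂
  have hest₁ : |dirichletEigenvalue Ω₁ n - dirichletEigenvalue Ω₂ n| ≤
      max (dirichletEigenvalue Ω₁ n ^ 2) (dirichletEigenvalue Ω₂ n ^ 2) *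
        sobolevConst (sobolevExponent p) ^ 2 *
        (discNorm (deriv φ₁) p + discNorm (deriv φ₂) p) *
        discNorm (fun z => ‖deriv φ₁ z‖ - ‖deriv φ₂ z‖) 2 := by
    refine hest.trans_eq ?_
    rw [hδ_def]
    ring
  refine ⟨hL₁, hL₂, hest₁, hest₁.trans ?_⟩
  refine mul_le_mul_of_nonneg_left (discNorm_sub_le_sqrt h₁ h₂ (hφ₁.mono_exponent hp.le)
    (hφ₂.mono_exponent hp.le)) ?_
  exact mul_nonneg (mul_nonneg (le_max_of_le_left (sq_nonneg _)) (sq_nonneg _))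
    (add_nonneg (discNorm_nonneg _ _) (discNorm_nonneg _ _))
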